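/- Let $d\ge 1$ and let $A\in[-1,1]^{d\times d}$ be an unknown zero-sum game; the row player minimizes and the column player maximizes $x^\top A y$ over mixed strategies $x,y\in\Delta_d=\{x\in\mathbb R^d_{\ge 0}:\sum_i x_i=1\}$. Write $\mathrm{DGap}(x,y)=\max_{y'\in\Delta_d}x^\top A y'-\min_{x'\in\Delta_d}x'^\top A y$. In each round $t=1,2,\dots$ the players choose $x_t,y_t\in\Delta_d$, sample independently (given the past) $i_t\sim x_t$ and $j_t\sim y_t$, and both observe $i_t$, $j_t$ and a feedback $r_t\in[-1,1]$ whose conditional mean given the past and $(i_t,j_t)$ is $A_{i_tj_t}$. Fix $\delta\in(0,1)$ and let both players run PMO-LB with $\gamma_s=128\,d\,2^{-s/2}\sqrt{\log(8d^2s^2/\delta)}$: epoch $s\ge1$ consists of the rounds $2^{s-1},\dots,2^s-1$, in all of which $x_t=x_s$ and $y_t=y_s$, where $$x_s=\operatorname*{argmin}_{x\in\Delta_d}\max_{y\in\Delta_d}\Phi_s(x,y),\qquad y_s=\operatorname*{argmax}_{y\in\Delta_d}\min_{x\in\Delta_d}\Phi_s(x,y),$$ $$\Phi_s(x,y)=x^\top\widehat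 A_s y+\gamma_s\sum_{i=1}^d\log\frac1{x_i}-\gamma_s\sum_{j=1}^d\log\frac1{y_j}.$$ Here each player's strategy ranges over the strictly positive vectors of $\Delta_d$ (the barrier is infinite elsewhere), $\widehat A_1=0$, and for $s\ge1$ the entry $\widehat A_{s+1,ij}$ is the average of the feedback $r_t$ over the rounds $t$ of epoch $s$ with $(i_t,j_t)=(i,j)$, or $0$ if there is no such round. Then there is a universal constant $C>0$ (independent of $d$, $A$, $\delta$ and the law of the feedback) such that, with probability at least $1-\delta$, for all $t\ge1$ simultaneously, $$\mathrm{DGap}(x_t,y_t)\le C\,d^2\sqrt{\frac{\log\bigl(d\,\log(\max\{t,3\})/\delta\bigr)}{t}} .$$ -/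

import Mathlib

open MeasureTheory
open scoped Matrix

namespace PMOLB

/-- The relative interior of the probability simplex: all entries are positive and sum to one. -/
def openSimplex (d : ℕ) : Set (Fin d → ℝ) :=
  {x | x ∈ stdSimplex ℝ (Fin d) ∧ ∀ i, 0 < x i}

/-- The duality gap of `(x, y)` in the zero-sum game `A`, where the row player minimizes:
the maximum of `xᵀ A y'` over the simplex minus the minimum of `x'ᵀ A y` over the simplex. -/
noncomputable def dualityGap {d : ℕ} (A : Matrix (Fin d) (Fin d) ℝ) (x y : Fin d → ℝ) : ℝ :=
  sSup ((fun y' => x ⬝ᵥ (A *ᵥ y')) '' stdSimplex ℝ (Fin d)) -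
    sInf ((fun x' => x' ⬝ᵥ (A *ᵥ y)) '' stdSimplex ℝ (Fin d))

/-- The payoff of the log-barrier-regularized game with matrix `M` and learning rate `g`. -/
noncomputable def regPayoff {d : ℕ} (g : ℝ) (M : Matrix (Fin d) (Fin d) ℝ)
    (x y : Fin d → ℝ) : ℝ :=
  x ⬝ᵥ (M *ᵥ y) + g * ∑ i, Real.log (1 / x i) - g * ∑ j, Real.log (1 / y j)

/-- `x` is an argmin over `x` of the max over `y` of the regularized payoff. The barrier of a player
is `+∞` on the boundary of the simplex, so that both players range over the relative interior.
The inner maximum is taken in the extended reals, so that no boundedness is presupposed. -/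
def IsRowMinimax {d : ℕ} (g : ℝ) (M : Matrix (Fin d) (Fin d) ℝ) (x : Fin d → ℝ) : Prop :=
  x ∈ openSimplex d ∧ ∀ x' ∈ openSimplex d,
    (⨆ y ∈ openSimplex d, (regPayoff g M x y : EReal)) ≤
      ⨆ y ∈ openSimplex d, (regPayoff g M x' y : EReal)

/-- `y` is an argmax over `y` of the min over `x` of the regularized payoff. -/
def IsColMaximin {d : ℕ} (g : ℝ) (M : Matrix (Fin d) (Fin d) ℝ) (y : Fin d → ℝ) : Prop :=
  y ∈ openSimplex d ∧ ∀ y' ∈ openSimplex d,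
    (⨅ x ∈ openSimplex d, (regPayoff g M x y' : EReal)) ≤
      ⨅ x ∈ openSimplex d, (regPayoff g M x y : EReal)

/-- The row player's strategy: the minimax strategy of the regularized game. -/
noncomputable def rowStrategy {d : ℕ} (g : ℝ) (M : Matrix (Fin d) (Fin d) ℝ) : Fin d → ℝ :=
  Classical.epsilon (IsRowMinimax g M)

/-- The column player's strategy: the maximin strategy of the regularized game. -/
noncomputable def colStrategy {d : ℕ} (g : ℝ) (M : Matrix (Fin d) (Fin d) ℝ) : Fin d → ℝ :=
  Classical.epsilon (IsColMaximin g M)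

/-- The rounds `2 ^ (s - 1), …, 2 ^ s - 1` of epoch `s ≥ 1`. -/
def epochRounds (s : ℕ) : Finset ℕ := Finset.Ico (2 ^ (s - 1)) (2 ^ s)

/-- The epoch that round `t ≥ 1` belongs to. -/
def epochOf (t : ℕ) : ℕ := Nat.log 2 t + 1

theorem mem_epochRounds_epochOf {t : ℕ} (ht : 1 ≤ t) : t ∈ epochRounds (epochOf t) := by
  simp only [epochRounds, epochOf, Finset.mem_Ico, Nat.add_sub_cancel]
  exact ⟨Nat.pow_log_le_self 2 (by omega), Nat.lt_pow_succ_log_self (by norm_num) t⟩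

/-- The number of rounds of epoch `s` in which the action pair `(a, b)` is played. -/
def pairCount {d : ℕ} (i j : ℕ → Fin d) (s : ℕ) (a b : Fin d) : ℕ :=
  ((epochRounds s).filter (fun t => i t = a ∧ j t = b)).card

/-- The game estimator of epoch `s`, from the actions `i`, `j` and the feedback `r`: zero for the
first epoch, and afterwards the empirical means over the previous epoch (zero for an action pair
that was not played in it). The index `0` is not used. -/
noncomputable def gameEstimate {d : ℕ} (i j : ℕ → Fin d) (r : ℕ → ℝ) :
    ℕ → Matrix (Fin d) (Fin d) ℝ
  | 0 => 0
  | 1 => 0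
  | s + 2 => fun a b =>
      if pairCount i j (s + 1) a b = 0 then 0
      else (∑ t ∈ epochRounds (s + 1), if i t = a ∧ j t = b then r t else 0) /
        (pairCount i j (s + 1) a b : ℝ)

/-- The row player's strategy in round `t`, with learning rates `g`, on given observations. -/
noncomputable def rowPlay {d : ℕ} (g : ℕ → ℝ) (i j : ℕ → Fin d) (r : ℕ → ℝ) (t : ℕ) :
    Fin d → ℝ :=
  rowStrategy (g (epochOf t)) (gameEstimate i j r (epochOf t))

/-- The column player's strategy in round `t`, with learning rates `g`, on given observations. -/
noncomputable def colPlay {d : ℕ} (g : ℕ → ℝ) (i j : ℕ → Fin d) (r : ℕ → ℝ) (t : ℕ) :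
    Fin d → ℝ :=
  colStrategy (g (epochOf t)) (gameEstimate i j r (epochOf t))

/-- The sigma-algebra generated by everything observed in the rounds `1, …, t - 1`. -/
@[reducible]
def history {Ω : Type*} {d : ℕ} (i j : ℕ → Ω → Fin d) (r : ℕ → Ω → ℝ) (t : ℕ) :
    MeasurableSpace Ω :=
  ⨆ τ ∈ Finset.Ico 1 t, (MeasurableSpace.comap (i τ) inferInstance ⊔
    MeasurableSpace.comap (j τ) inferInstance ⊔ MeasurableSpace.comap (r τ) inferInstance)

/-- The random actions `i t`, `j t` and feedback `r t`, for rounds `t = 1, 2, …`, arise when both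
players run the algorithm with learning rates `g` in the game `A`: given the past, `i t` and `j t`
are sampled independently from the two strategies of round `t`; the feedback lies in `[-1, 1]` and
has conditional mean `A (i t) (j t)` given the past and the two actions of the round. -/
structure IsRun {Ω : Type*} [MeasurableSpace Ω] (μ : Measure Ω) {d : ℕ}
    (A : Matrix (Fin d) (Fin d) ℝ) (g : ℕ → ℝ)
    (i j : ℕ → Ω → Fin d) (r : ℕ → Ω → ℝ) : Prop where
  measurable_row : ∀ t, 1 ≤ t → Measurable (i t)
  measurable_col : ∀ t, 1 ≤ t → Measurable (j t)
  measurable_feedback : ∀ t, 1 ≤ t → Measurable (r t)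
  sampling : ∀ t, 1 ≤ t → ∀ a b : Fin d,
    μ[{ω | i t ω = a ∧ j t ω = b}.indicator (fun _ => (1 : ℝ)) | history i j r t] =ᵐ[μ]
      fun ω => rowPlay g (fun τ => i τ ω) (fun τ => j τ ω) (fun τ => r τ ω) t a *
        colPlay g (fun τ => i τ ω) (fun τ => j τ ω) (fun τ => r τ ω) t b
  feedback_mem : ∀ t, 1 ≤ t → ∀ᵐ ω ∂μ, r t ω ∈ Set.Icc (-1 : ℝ) 1
  feedback_mean : ∀ t, 1 ≤ t →
    μ[r t | history i j r t ⊔ (MeasurableSpace.comap (i t) inferInstance ⊔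
      MeasurableSpace.comap (j t) inferInstance)] =ᵐ[μ] fun ω => A (i t ω) (j t ω)

/-- The learning rate `128 d 2^(-s/2) √(log (8 d² s² / δ))` of epoch `s ≥ 1`. -/
noncomputable def learningRate (d : ℕ) (δ : ℝ) (s : ℕ) : ℝ :=
  128 * (d : ℝ) * (2 : ℝ) ^ (-(s : ℝ) / 2) *
    Real.sqrt (Real.log (8 * (d : ℝ) ^ 2 * (s : ℝ) ^ 2 / δ))

end PMOLB

namespace PMOLB

/-! The barrier plays two roles: it keeps every action pair sampled often enough to be estimated,
and its slack `g / x i` in the optimality conditions absorbs the estimation error.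

The pair of strategies of an epoch is the unique saddle point of the regularized game, characterized
by `(M y) i = v - g d + g / x i` and `(x M) j = v + g d - g / y j`, where `v = x M y`. With no
estimation error these equations alone give a gap of at most `2 g d`. An entry sampled with
probability `p i * q j` in the previous epoch, by its strategies `p` and `q`, is known up to about
`g / (16 d) / √(p i * q j)`. If `∑ x i / p i` and `∑ y j / q j` are `O(d)`, Cauchy-Schwarz turns
this into a row error of at most `g / √(x i)`, and `g / √a - g / a ≤ g / 2`. The gap is then at most
`3 g d` (`dualityGap_le_of_noise`).

What remains is that consecutive strategies have bounded ratios. They are compared through the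
equilibria of the true game `A` with the same learning rates. For `A` itself, summing the optimality
equations shows that equilibria for two rates have total ratio at most `4 d` (`sum_ratio_le`). A
symmetrized Bregman identity shows that the played pair stays within a factor 2 of the true
equilibrium when the error is small relative to the sampling probabilities (`barrierDist_le`). These
two facts feed each other in an induction over epochs (`dualityGap_strategies_le`): factor 2 in
epoch `s` gives ratio `8 d` for the next true equilibrium, hence factor 2 again and ratio `16 d` for
the next played pair.

The accuracy holds with high probability by exponential supermartingales for the counts and the
feedback deviations (`concentration`) and a union bound over pairs and epochs. While the rate is at
least 8, no accuracy is needed, since gaps never exceed 2. -/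

/-! ### The log-barrier cost and its minimizers -/

/-- A linear cost plus the log-barrier. -/
noncomputable def barrierCost {d : ℕ} (g : ℝ) (c x : Fin d → ℝ) : ℝ :=
  x ⬝ᵥ c + g * ∑ i, Real.log (1 / x i)

theorem regPayoff_eq_row {d : ℕ} (g : ℝ) (M : Matrix (Fin d) (Fin d) ℝ) (x y : Fin d → ℝ) :
    regPayoff g M x y = barrierCost g (M *ᵥ y) x - g * ∑ j, Real.log (1 / y j) := rfl

theorem regPayoff_eq_col {d : ℕ} (g : ℝ) (M : Matrix (Fin d) (Fin d) ℝ) (x y : Fin d → ℝ) :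
    regPayoff g M x y = -barrierCost g (-(x ᵥ* M)) y + g * ∑ i, Real.log (1 / x i) := by
  simp only [regPayoff, barrierCost, dotProduct_neg, Matrix.dotProduct_mulVec]
  rw [dotProduct_comm y]
  ring

/-- The tangent inequality of the barrier cost. -/
theorem barrierCost_tangent_le {d : ℕ} {g : ℝ} (hg : 0 < g) (c : Fin d → ℝ) {x x' : Fin d → ℝ}
    (hx : ∀ i, 0 < x i) (hx' : ∀ i, 0 < x' i) :
    barrierCost g c x + ∑ i, (c i - g / x i) * (x' i - x i) ≤ barrierCost g c x' := by
  simp only [barrierCost, dotProduct, Finset.mul_sum, ← Finset.sum_add_distrib]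
  refine Finset.sum_le_sum fun i _ => ?_
  have h := Real.log_le_sub_one_of_pos (div_pos (hx' i) (hx i))
  rw [Real.log_div (hx' i).ne' (hx i).ne'] at h
  simp only [one_div, Real.log_inv]
  have h2 : g / x i * (x' i - x i) = g * (x' i / x i - 1) := by
    have := (hx i).ne'
    field_simp
  nlinarith [mul_le_mul_of_nonneg_left h hg.le]

theorem barrierCost_tangent_lt {d : ℕ} {g : ℝ} (hg : 0 < g) (c : Fin d → ℝ) {x x' : Fin d → ℝ}
    (hx : ∀ i, 0 < x i) (hx' : ∀ i, 0 < x' i) (hne : x' ≠ x) :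
    barrierCost g c x + ∑ i, (c i - g / x i) * (x' i - x i) < barrierCost g c x' := by
  simp only [barrierCost, dotProduct, Finset.mul_sum, ← Finset.sum_add_distrib]
  have key : ∀ i, g / x i * (x' i - x i) = g * (x' i / x i - 1) := fun i => by
    have := (hx i).ne'
    field_simp
  obtain ⟨k, hk⟩ := Function.ne_iff.1 hne
  refine Finset.sum_lt_sum (fun i _ => ?_) ⟨k, Finset.mem_univ k, ?_⟩
  · have h := Real.log_le_sub_one_of_pos (div_pos (hx' i) (hx i))
    rw [Real.log_div (hx' i).ne' (hx i).ne'] at h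
    simp only [one_div, Real.log_inv]
    nlinarith [mul_le_mul_of_nonneg_left h hg.le, key i]
  · have h := Real.log_lt_sub_one_of_pos (div_pos (hx' k) (hx k))
      (fun h => hk ((div_eq_one_iff_eq (hx k).ne').1 h))
    rw [Real.log_div (hx' k).ne' (hx k).ne'] at h
    simp only [one_div, Real.log_inv]
    nlinarith [mul_lt_mul_of_pos_left h hg, key k]

/-- The simplex with all entries at least `η`. -/
def truncSimplex (d : ℕ) (η : ℝ) : Set (Fin d → ℝ) :=
  {x | x ∈ stdSimplex ℝ (Fin d) ∧ ∀ i, η ≤ x i}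

theorem convex_truncSimplex (d : ℕ) (η : ℝ) : Convex ℝ (truncSimplex d η) := by
  have : truncSimplex d η = stdSimplex ℝ (Fin d) ∩ Set.Ici (fun _ => η) := by
    ext x; simp [truncSimplex, Pi.le_def]
  rw [this]
  exact (convex_stdSimplex ℝ (Fin d)).inter (convex_Ici _)

theorem isCompact_truncSimplex (d : ℕ) (η : ℝ) : IsCompact (truncSimplex d η) := by
  have : truncSimplex d η = stdSimplex ℝ (Fin d) ∩ Set.Ici (fun _ => η) := by
    ext x; simp [truncSimplex, Pi.le_def]
  rw [this]
  exact (isCompact_stdSimplex ℝ (Fin d)).inter_right isClosed_Ici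

/-- First-order optimality of a minimizer of the barrier cost. -/
theorem barrierCost_variational {d : ℕ} {g : ℝ} (hg : 0 < g) {c x : Fin d → ℝ}
    {S : Set (Fin d → ℝ)} (hS : Convex ℝ S) (hpos : ∀ z ∈ S, ∀ i, 0 < z i) (hx : x ∈ S)
    (hmin : ∀ z ∈ S, barrierCost g c x ≤ barrierCost g c z) {z : Fin d → ℝ} (hz : z ∈ S) :
    0 ≤ ∑ i, (c i - g / x i) * (z i - x i) := by
  have hmem : ∀ t ∈ Set.Ioc (0 : ℝ) 1, x + t • (z - x) ∈ S := fun t ht =>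
    hS.add_smul_sub_mem hx hz ⟨ht.1.le, ht.2⟩
  have hstep : ∀ t ∈ Set.Ioc (0 : ℝ) 1,
      0 ≤ ∑ i, (c i - g / (x i + t * (z i - x i))) * (z i - x i) := by
    intro t ht
    -- The tangent is taken at the moved point and evaluated back at `x`, so that minimality signs
    -- the slope there. Letting `t` tend to 0 replaces differentiation.
    have h1 := barrierCost_tangent_le hg c (hpos _ (hmem t ht)) (hpos x hx)
    have h2 := hmin _ (hmem t ht)
    have h3 : ∑ i, (c i - g / (x + t • (z - x)) i) * (x i - (x + t • (z - x)) i) =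
        -t * ∑ i, (c i - g / (x i + t * (z i - x i))) * (z i - x i) := by
      rw [Finset.mul_sum]
      refine Finset.sum_congr rfl fun i _ => ?_
      simp only [Pi.add_apply, Pi.smul_apply, Pi.sub_apply, smul_eq_mul]
      ring
    rw [h3] at h1
    by_contra hneg
    push Not at hneg
    nlinarith [mul_neg_of_pos_of_neg ht.1 hneg]
  have hlim : Filter.Tendsto
      (fun t : ℝ => ∑ i, (c i - g / (x i + t * (z i - x i))) * (z i - x i))
      (nhdsWithin 0 (Set.Ioi 0)) (nhds (∑ i, (c i - g / x i) * (z i - x i))) := by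
    refine tendsto_finsetSum _ fun i _ => ?_
    have hc : ContinuousAt (fun t : ℝ => (c i - g / (x i + t * (z i - x i))) * (z i - x i)) 0 := by
      refine ContinuousAt.mul (continuousAt_const.sub (continuousAt_const.div ?_ ?_))
        continuousAt_const
      · fun_prop
      · simpa using (hpos x hx i).ne'
    have := hc.tendsto
    simp only [zero_mul, add_zero] at this
    exact this.mono_left nhdsWithin_le_nhds
  refine ge_of_tendsto hlim ?_
  filter_upwards [Ioc_mem_nhdsGT (zero_lt_one' ℝ)] with t ht using hstep t ht

/-- A minimizer of the barrier cost over the truncated simplex does not feel the truncation when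
this is small, and solves the first-order equations. -/
theorem barrierCost_minimizer_eq {d : ℕ} [NeZero d] {g : ℝ} (hg : 0 < g) {c x : Fin d → ℝ} {B η : ℝ}
    (hc : ∀ i, |c i| ≤ B) (hη : 0 < η) (hηd : η ≤ 1 / d) (hηg : η * (d * (2 * B + g * d)) < g)
    (hx : x ∈ truncSimplex d η)
    (hmin : ∀ z ∈ truncSimplex d η, barrierCost g c x ≤ barrierCost g c z) (i : Fin d) :
    c i = x ⬝ᵥ c - g * d + g / x i := by
  have hd : (0 : ℝ) < d := Nat.cast_pos.2 (NeZero.pos d)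
  have hpos : ∀ z ∈ truncSimplex d η, ∀ i, 0 < z i := fun z hz i => hη.trans_le (hz.2 i)
  have hvar := fun z hz => barrierCost_variational hg (convex_truncSimplex d η) hpos hx hmin (z := z) hz
  have hsum : ∑ i, x i = 1 := hx.1.2
  -- Testing optimality against the uniform vector bounds the average of `g / x i` by `2 * B + g *
  -- d`, which keeps every entry above `η`.
  have hint : ∀ i, η < x i := by
    have hu : (fun _ => 1 / (d : ℝ)) ∈ truncSimplex d η := by
      refine ⟨⟨fun _ => by positivity, ?_⟩, fun _ => hηd⟩
      simp [hd.ne']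
    have h := hvar _ hu
    intro i
    have e1 : ∑ i, (c i - g / x i) * (1 / (d : ℝ) - x i) =
        (∑ i, c i * (1 / (d : ℝ))) - (∑ i, c i * x i) - (∑ i, g / x i * (1 / (d : ℝ))) + g * d := by
      have : ∀ i, (c i - g / x i) * (1 / (d : ℝ) - x i) =
          c i * (1 / (d : ℝ)) - c i * x i - g / x i * (1 / (d : ℝ)) + g := fun i => by
        have := (hpos x hx i).ne'
        field_simp
        ring
      simp only [this, Finset.sum_add_distrib, Finset.sum_sub_distrib]
      simp [mul_comm]
    have e2 : ∑ i, c i * (1 / (d : ℝ)) ≤ B := by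
      calc ∑ i, c i * (1 / (d : ℝ)) ≤ ∑ _i : Fin d, B * (1 / (d : ℝ)) :=
            Finset.sum_le_sum fun i _ =>
              mul_le_mul_of_nonneg_right ((le_abs_self _).trans (hc i)) (by positivity)
        _ = B := by simp; field_simp
    have e3 : -B ≤ ∑ i, c i * x i := by
      calc -B = ∑ i, (-B) * x i := by rw [← Finset.mul_sum, hsum, mul_one]
        _ ≤ ∑ i, c i * x i := Finset.sum_le_sum fun i _ =>
              mul_le_mul_of_nonneg_right (neg_le_of_abs_le (hc i)) (hpos x hx i).le
    have e4 : g / x i * (1 / (d : ℝ)) ≤ ∑ i, g / x i * (1 / (d : ℝ)) :=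
      Finset.single_le_sum (f := fun i => g / x i * (1 / (d : ℝ)))
        (fun k _ => by have := hpos x hx k; positivity) (Finset.mem_univ i)
    have e5 : g / x i * (1 / (d : ℝ)) ≤ 2 * B + g * d := by linarith
    by_contra hle
    push Not at hle
    have hxi := hpos x hx i
    rw [← mul_div_assoc, mul_one, div_div, div_le_iff₀ (by positivity)] at e5
    have h0 : 0 ≤ 2 * B + g * d := by
      have : 0 ≤ B := (abs_nonneg _).trans (hc i)
      positivity
    have : x i * (d * (2 * B + g * d)) ≤ η * (d * (2 * B + g * d)) :=
      mul_le_mul_of_nonneg_right hle (by positivity)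
    nlinarith
  -- Since no lower bound is active, mass `x k - η` can be moved from `k` to `i`; in both directions
  -- this makes the partial derivatives equal. Their common value is then found by averaging with
  -- weights `x`.
  have hle : ∀ i k, i ≠ k → c k - g / x k ≤ c i - g / x i := by
    intro i k hik
    set s := x k - η with hs
    have hspos : 0 < s := sub_pos.2 (hint k)
    have hmem : (x + Pi.single i s - Pi.single k s : Fin d → ℝ) ∈ truncSimplex d η := by
      have hge : ∀ j, η ≤ (x + Pi.single i s - Pi.single k s : Fin d → ℝ) j := by
        intro j
        simp only [Pi.add_apply, Pi.sub_apply]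
        by_cases hjk : j = k
        · subst hjk
          simp [Pi.single_eq_of_ne hik.symm, hs]
        · have : (0 : ℝ) ≤ (Pi.single i s : Fin d → ℝ) j := by
            by_cases hji : j = i
            · subst hji; simpa using hspos.le
            · simp [Pi.single_eq_of_ne hji]
          rw [Pi.single_eq_of_ne hjk]
          linarith [hint j]
      refine ⟨⟨fun j => hη.le.trans (hge j), ?_⟩, hge⟩
      simp [Finset.sum_add_distrib, Finset.sum_sub_distrib, hsum]
    have h := hvar _ hmem
    have : ∑ j, (c j - g / x j) * ((x + Pi.single i s - Pi.single k s : Fin d → ℝ) j - x j) =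
        (c i - g / x i) * s - (c k - g / x k) * s := by
      have : ∀ j, (c j - g / x j) * ((x + Pi.single i s - Pi.single k s : Fin d → ℝ) j - x j) =
          (c j - g / x j) * (Pi.single i s : Fin d → ℝ) j -
            (c j - g / x j) * (Pi.single k s : Fin d → ℝ) j := fun j => by
        simp only [Pi.add_apply, Pi.sub_apply]
        ring
      simp only [this, Finset.sum_sub_distrib]
      simp [Pi.single_apply]
    rw [this] at h
    nlinarith
  have hconst : ∀ k, c k - g / x k = c i - g / x i := fun k => by
    rcases eq_or_ne i k with rfl | hik
    · rfl
    · exact le_antisymm (hle i k hik) (hle k i hik.symm)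
  have : x ⬝ᵥ c - g * d = c i - g / x i := by
    have h1 : x ⬝ᵥ c - g * d = ∑ k, x k * (c k - g / x k) := by
      have : ∀ k, x k * (c k - g / x k) = x k * c k - g := fun k => by
        have := (hpos x hx k).ne'
        field_simp
      simp only [this, Finset.sum_sub_distrib]
      simp [dotProduct, mul_comm]
    rw [h1]
    simp only [hconst, ← Finset.sum_mul, hsum, one_mul]
  linarith

theorem convexOn_barrierCost {d : ℕ} {g η : ℝ} (hg : 0 < g) (hη : 0 < η) (c : Fin d → ℝ) :
    ConvexOn ℝ (truncSimplex d η) (barrierCost g c) := by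
  refine ⟨convex_truncSimplex d η, fun x hx z hz a b ha hb hab => ?_⟩
  have hpos : ∀ z ∈ truncSimplex d η, ∀ i, 0 < z i := fun z hz i => hη.trans_le (hz.2 i)
  have hw := convex_truncSimplex d η hx hz ha hb hab
  have h1 := mul_le_mul_of_nonneg_left (barrierCost_tangent_le hg c (hpos _ hw) (hpos x hx)) ha
  have h2 := mul_le_mul_of_nonneg_left (barrierCost_tangent_le hg c (hpos _ hw) (hpos z hz)) hb
  have h3 : a * ∑ i, (c i - g / (a • x + b • z) i) * (x i - (a • x + b • z) i) +
      b * ∑ i, (c i - g / (a • x + b • z) i) * (z i - (a • x + b • z) i) = 0 := by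
    rw [Finset.mul_sum, Finset.mul_sum, ← Finset.sum_add_distrib]
    refine Finset.sum_eq_zero fun i _ => ?_
    have : a * (x i - (a • x + b • z) i) + b * (z i - (a • x + b • z) i) = 0 := by
      simp only [Pi.add_apply, Pi.smul_apply, smul_eq_mul]
      have : b = 1 - a := by linarith
      subst this
      ring
    linear_combination (c i - g / (a • x + b • z) i) * this
  simp only [smul_eq_mul]
  have : barrierCost g c (a • x + b • z) =
      a * barrierCost g c (a • x + b • z) + b * barrierCost g c (a • x + b • z) := by
    rw [← add_mul, hab, one_mul]
  linarith

theorem continuousOn_barrierCost {d : ℕ} {η : ℝ} (g : ℝ) (hη : 0 < η) (c : Fin d → ℝ) :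
    ContinuousOn (barrierCost g c) (truncSimplex d η) := by
  unfold barrierCost
  refine ContinuousOn.add (by unfold dotProduct; fun_prop) (ContinuousOn.mul continuousOn_const ?_)
  refine continuousOn_finsetSum _ fun i _ => ContinuousOn.log ?_ ?_
  · exact continuousOn_const.div (by fun_prop) fun x hx => (hη.trans_le (hx.2 i)).ne'
  · exact fun x hx => (one_div_pos.2 (hη.trans_le (hx.2 i))).ne'

/-! ### Existence and uniqueness of the regularized equilibrium -/

/-- The first-order equations of a saddle point of the regularized game. -/
structure IsBarrierEquilibrium {d : ℕ} (g : ℝ) (M : Matrix (Fin d) (Fin d) ℝ)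
    (x y : Fin d → ℝ) : Prop where
  row_mem : x ∈ openSimplex d
  col_mem : y ∈ openSimplex d
  row_eq : ∀ i, (M *ᵥ y) i = x ⬝ᵥ (M *ᵥ y) - g * d + g / x i
  col_eq : ∀ j, (x ᵥ* M) j = x ⬝ᵥ (M *ᵥ y) + g * d - g / y j

/-- On the truncated simplex the payoff is continuous and convex-concave, so Sion's theorem gives a
saddle point. For small `η` the truncation is inactive, and the saddle point satisfies the
untruncated equations. -/
theorem exists_isBarrierEquilibrium {d : ℕ} [NeZero d] {g : ℝ} (hg : 0 < g)
    (M : Matrix (Fin d) (Fin d) ℝ) : ∃ x y, IsBarrierEquilibrium g M x y := by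
  have hd : (0 : ℝ) < d := Nat.cast_pos.2 (NeZero.pos d)
  set B : ℝ := ∑ i, ∑ j, |M i j| with hB
  have hB0 : 0 ≤ B := Finset.sum_nonneg fun i _ => Finset.sum_nonneg fun j _ => abs_nonneg _
  obtain ⟨η, hη, hη'⟩ : ∃ η : ℝ, 0 < η ∧ η < min (1 / (d : ℝ)) (g / (d * (2 * B + g * d))) :=
    exists_between (by positivity)
  have hηd : η ≤ 1 / d := hη'.le.trans (min_le_left _ _)
  have hηg : η * (d * (2 * B + g * d)) < g :=
    (lt_div_iff₀ (by positivity)).1 (hη'.trans_le (min_le_right _ _))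
  have hne : (truncSimplex d η).Nonempty := by
    refine ⟨fun _ => 1 / (d : ℝ), ⟨fun _ => by positivity, ?_⟩, fun _ => hηd⟩
    simp [hd.ne']
  have hpos : ∀ z ∈ truncSimplex d η, ∀ i, 0 < z i := fun z hz i => hη.trans_le (hz.2 i)
  have hle1 : ∀ z ∈ truncSimplex d η, ∀ i, |z i| ≤ 1 := fun z hz i => by
    rw [abs_of_pos (hpos z hz i), ← hz.1.2]
    exact Finset.single_le_sum (fun k _ => (hpos z hz k).le) (Finset.mem_univ i)
  obtain ⟨x, hx, y, hy, hxy⟩ := Sion.exists_isSaddlePointOn (f := fun x y => regPayoff g M x y) hne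
    (convex_truncSimplex d η) (isCompact_truncSimplex d η)
    (fun y _ => ((continuousOn_barrierCost g hη (M *ᵥ y)).sub continuousOn_const).lowerSemicontinuousOn)
    (fun y _ => ((convexOn_barrierCost hg hη (M *ᵥ y)).add_const
      (-(g * ∑ j, Real.log (1 / y j)))).quasiconvexOn)
    (convex_truncSimplex d η) hne (isCompact_truncSimplex d η)
    (fun x _ => by
      simp only [regPayoff_eq_col]
      exact ((continuousOn_barrierCost g hη _).neg.add continuousOn_const).upperSemicontinuousOn)
    (fun x _ => by
      simp only [regPayoff_eq_col]
      exact ((convexOn_barrierCost hg hη _).neg.add_const _).quasiconcaveOn)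
  have hrow : ∀ z ∈ truncSimplex d η,
      barrierCost g (M *ᵥ y) x ≤ barrierCost g (M *ᵥ y) z := fun z hz => by
    have := hxy z hz y hy
    simp only [regPayoff_eq_row] at this
    linarith
  have hcol : ∀ z ∈ truncSimplex d η,
      barrierCost g (-(x ᵥ* M)) y ≤ barrierCost g (-(x ᵥ* M)) z := fun z hz => by
    have := hxy x hx z hz
    simp only [regPayoff_eq_col] at this
    linarith
  have hbrow : ∀ i, |(M *ᵥ y) i| ≤ B := fun i => by
    calc |(M *ᵥ y) i| ≤ ∑ j, |M i j * y j| := by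
          simp only [Matrix.mulVec, dotProduct]
          exact Finset.abs_sum_le_sum_abs _ _
      _ ≤ ∑ j, |M i j| := Finset.sum_le_sum fun j _ => by
          rw [abs_mul]; exact mul_le_of_le_one_right (abs_nonneg _) (hle1 y hy j)
      _ ≤ B := Finset.single_le_sum (f := fun i => ∑ j, |M i j|)
          (fun k _ => Finset.sum_nonneg fun j _ => abs_nonneg _) (Finset.mem_univ i)
  have hbcol : ∀ j, |(-(x ᵥ* M)) j| ≤ B := fun j => by
    calc |(-(x ᵥ* M)) j| = |(x ᵥ* M) j| := by simp
      _ ≤ ∑ i, |x i * M i j| := by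
          simp only [Matrix.vecMul, dotProduct]
          exact Finset.abs_sum_le_sum_abs _ _
      _ ≤ ∑ i, |M i j| := Finset.sum_le_sum fun i _ => by
          rw [abs_mul]; exact mul_le_of_le_one_left (abs_nonneg _) (hle1 x hx i)
      _ ≤ B := Finset.sum_le_sum fun i _ =>
          Finset.single_le_sum (f := fun j => |M i j|) (fun k _ => abs_nonneg _) (Finset.mem_univ j)
  refine ⟨x, y, ⟨hx.1, hpos x hx⟩, ⟨hy.1, hpos y hy⟩, fun i =>
    barrierCost_minimizer_eq hg hbrow hη hηd hηg hx hrow i, fun j => ?_⟩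
  have h := barrierCost_minimizer_eq hg hbcol hη hηd hηg hy hcol j
  rw [dotProduct_neg, dotProduct_comm y, ← Matrix.dotProduct_mulVec, Pi.neg_apply] at h
  linarith

namespace IsBarrierEquilibrium

variable {d : ℕ} {g : ℝ} {M : Matrix (Fin d) (Fin d) ℝ} {x y : Fin d → ℝ}

theorem row_tangent_eq_zero (h : IsBarrierEquilibrium g M x y) {z : Fin d → ℝ}
    (hz : z ∈ openSimplex d) : ∑ i, ((M *ᵥ y) i - g / x i) * (z i - x i) = 0 := by
  have : ∀ i, (M *ᵥ y) i - g / x i = x ⬝ᵥ (M *ᵥ y) - g * d := fun i => by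
    linarith [h.row_eq i]
  simp only [this, ← Finset.mul_sum, Finset.sum_sub_distrib]
  rw [hz.1.2, h.row_mem.1.2]
  ring

theorem col_tangent_eq_zero (h : IsBarrierEquilibrium g M x y) {z : Fin d → ℝ}
    (hz : z ∈ openSimplex d) : ∑ j, ((-(x ᵥ* M)) j - g / y j) * (z j - y j) = 0 := by
  have : ∀ j, (-(x ᵥ* M)) j - g / y j = -(x ⬝ᵥ (M *ᵥ y)) - g * d := fun j => by
    rw [Pi.neg_apply]
    linarith [h.col_eq j]
  simp only [this, ← Finset.mul_sum, Finset.sum_sub_distrib]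
  rw [hz.1.2, h.col_mem.1.2]
  ring

theorem row_le (h : IsBarrierEquilibrium g M x y) (hg : 0 < g) {z : Fin d → ℝ}
    (hz : z ∈ openSimplex d) : regPayoff g M x y ≤ regPayoff g M z y := by
  have := barrierCost_tangent_le hg (M *ᵥ y) h.row_mem.2 hz.2
  rw [h.row_tangent_eq_zero hz] at this
  simp only [regPayoff_eq_row]
  linarith

theorem row_lt (h : IsBarrierEquilibrium g M x y) (hg : 0 < g) {z : Fin d → ℝ}
    (hz : z ∈ openSimplex d) (hne : z ≠ x) : regPayoff g M x y < regPayoff g M z y := by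
  have := barrierCost_tangent_lt hg (M *ᵥ y) h.row_mem.2 hz.2 hne
  rw [h.row_tangent_eq_zero hz] at this
  simp only [regPayoff_eq_row]
  linarith

theorem col_le (h : IsBarrierEquilibrium g M x y) (hg : 0 < g) {z : Fin d → ℝ}
    (hz : z ∈ openSimplex d) : regPayoff g M x z ≤ regPayoff g M x y := by
  have := barrierCost_tangent_le hg (-(x ᵥ* M)) h.col_mem.2 hz.2
  rw [h.col_tangent_eq_zero hz] at this
  simp only [regPayoff_eq_col]
  linarith

theorem col_lt (h : IsBarrierEquilibrium g M x y) (hg : 0 < g) {z : Fin d → ℝ}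
    (hz : z ∈ openSimplex d) (hne : z ≠ y) : regPayoff g M x z < regPayoff g M x y := by
  have := barrierCost_tangent_lt hg (-(x ᵥ* M)) h.col_mem.2 hz.2 hne
  rw [h.col_tangent_eq_zero hz] at this
  simp only [regPayoff_eq_col]
  linarith

/-- The saddle inequalities make `x` a minimax strategy, so the choice operator returns some minimax
strategy. Any such strategy does no worse than `x` against `y`, which strict convexity allows only
for `x` itself. -/
theorem rowStrategy_eq (h : IsBarrierEquilibrium g M x y) (hg : 0 < g) : rowStrategy g M = x := by
  have hsup : (⨆ z ∈ openSimplex d, (regPayoff g M x z : EReal)) ≤ (regPayoff g M x y : EReal) :=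
    iSup₂_le fun z hz => EReal.coe_le_coe_iff.2 (h.col_le hg hz)
  have hex : IsRowMinimax g M x := ⟨h.row_mem, fun x' hx' => hsup.trans <|
    (EReal.coe_le_coe_iff.2 (h.row_le hg hx')).trans
      (le_iSup₂ (f := fun z (_ : z ∈ openSimplex d) => (regPayoff g M x' z : EReal)) y h.col_mem)⟩
  have hspec : IsRowMinimax g M (rowStrategy g M) := Classical.epsilon_spec ⟨x, hex⟩
  by_contra hne
  have h1 := h.row_lt hg hspec.1 hne
  have h2 : (regPayoff g M (rowStrategy g M) y : EReal) ≤ regPayoff g M x y :=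
    (le_iSup₂ (f := fun z (_ : z ∈ openSimplex d) =>
      (regPayoff g M (rowStrategy g M) z : EReal)) y h.col_mem).trans
      ((hspec.2 x h.row_mem).trans hsup)
  exact absurd (EReal.coe_le_coe_iff.1 h2) (not_le.2 h1)

theorem colStrategy_eq (h : IsBarrierEquilibrium g M x y) (hg : 0 < g) : colStrategy g M = y := by
  have hinf : (regPayoff g M x y : EReal) ≤ ⨅ z ∈ openSimplex d, (regPayoff g M z y : EReal) :=
    le_iInf₂ fun z hz => EReal.coe_le_coe_iff.2 (h.row_le hg hz)
  have hex : IsColMaximin g M y := ⟨h.col_mem, fun y' hy' =>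
    ((iInf₂_le (f := fun z (_ : z ∈ openSimplex d) => (regPayoff g M z y' : EReal))
      x h.row_mem).trans (EReal.coe_le_coe_iff.2 (h.col_le hg hy'))).trans hinf⟩
  have hspec : IsColMaximin g M (colStrategy g M) := Classical.epsilon_spec ⟨y, hex⟩
  by_contra hne
  have h1 := h.col_lt hg hspec.1 hne
  have h2 : (regPayoff g M x y : EReal) ≤ regPayoff g M x (colStrategy g M) :=
    (hinf.trans (hspec.2 y h.col_mem)).trans
      (iInf₂_le (f := fun z (_ : z ∈ openSimplex d) =>
        (regPayoff g M z (colStrategy g M) : EReal)) x h.row_mem)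
  exact absurd (EReal.coe_le_coe_iff.1 h2) (not_le.2 h1)

end IsBarrierEquilibrium

/-- The strategies of the two players form the equilibrium of the regularized game. -/
theorem isBarrierEquilibrium_strategies {d : ℕ} [NeZero d] {g : ℝ} (hg : 0 < g)
    (M : Matrix (Fin d) (Fin d) ℝ) :
    IsBarrierEquilibrium g M (rowStrategy g M) (colStrategy g M) := by
  obtain ⟨x, y, h⟩ := exists_isBarrierEquilibrium hg M
  rw [h.rowStrategy_eq hg, h.colStrategy_eq hg]
  exact h

/-! ### Bounds on payoffs and on the duality gap -/

theorem dualityGap_le {d : ℕ} [NeZero d] {A : Matrix (Fin d) (Fin d) ℝ} {x y : Fin d → ℝ} {U L : ℝ}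
    (hU : ∀ j, (x ᵥ* A) j ≤ U) (hL : ∀ i, L ≤ (A *ᵥ y) i) : dualityGap A x y ≤ U - L := by
  have hne : (stdSimplex ℝ (Fin d)).Nonempty := ⟨_, single_mem_stdSimplex ℝ (0 : Fin d)⟩
  refine sub_le_sub (csSup_le (hne.image _) ?_) (le_csInf (hne.image _) ?_)
  · rintro _ ⟨z, hz, rfl⟩
    calc x ⬝ᵥ (A *ᵥ z) = ∑ j, (x ᵥ* A) j * z j := by rw [Matrix.dotProduct_mulVec]; rfl
      _ ≤ ∑ j, U * z j := Finset.sum_le_sum fun j _ => mul_le_mul_of_nonneg_right (hU j) (hz.1 j)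
      _ = U := by rw [← Finset.mul_sum, hz.2, mul_one]
  · rintro _ ⟨z, hz, rfl⟩
    calc L = ∑ i, z i * L := by rw [← Finset.sum_mul, hz.2, one_mul]
      _ ≤ ∑ i, z i * (A *ᵥ y) i :=
        Finset.sum_le_sum fun i _ => mul_le_mul_of_nonneg_left (hL i) (hz.1 i)

theorem abs_mulVec_le {d : ℕ} {M : Matrix (Fin d) (Fin d) ℝ} {B : ℝ} (hM : ∀ i j, |M i j| ≤ B)
    {y : Fin d → ℝ} (hy : y ∈ stdSimplex ℝ (Fin d)) (i : Fin d) : |(M *ᵥ y) i| ≤ B := by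
  calc |(M *ᵥ y) i| ≤ ∑ j, |M i j * y j| := by
        simp only [Matrix.mulVec, dotProduct]
        exact Finset.abs_sum_le_sum_abs _ _
    _ ≤ ∑ j, B * y j := Finset.sum_le_sum fun j _ => by
        rw [abs_mul, abs_of_nonneg (hy.1 j)]
        exact mul_le_mul_of_nonneg_right (hM i j) (hy.1 j)
    _ = B := by rw [← Finset.mul_sum, hy.2, mul_one]

theorem abs_dotProduct_le {d : ℕ} {c : Fin d → ℝ} {B : ℝ} (hc : ∀ i, |c i| ≤ B)
    {x : Fin d → ℝ} (hx : x ∈ stdSimplex ℝ (Fin d)) : |x ⬝ᵥ c| ≤ B := by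
  calc |x ⬝ᵥ c| ≤ ∑ i, |x i * c i| := Finset.abs_sum_le_sum_abs _ _
    _ ≤ ∑ i, x i * B := Finset.sum_le_sum fun i _ => by
        rw [abs_mul, abs_of_nonneg (hx.1 i)]
        exact mul_le_mul_of_nonneg_left (hc i) (hx.1 i)
    _ = B := by rw [← Finset.sum_mul, hx.2, one_mul]

theorem abs_vecMul_le {d : ℕ} {M : Matrix (Fin d) (Fin d) ℝ} {B : ℝ} (hM : ∀ i j, |M i j| ≤ B)
    {x : Fin d → ℝ} (hx : x ∈ stdSimplex ℝ (Fin d)) (j : Fin d) : |(x ᵥ* M) j| ≤ B :=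
  abs_dotProduct_le (c := fun i => M i j) (fun i => hM i j) hx

theorem dualityGap_le_two {d : ℕ} [NeZero d] {A : Matrix (Fin d) (Fin d) ℝ}
    (hA : ∀ a b, |A a b| ≤ 1) {x y : Fin d → ℝ} (hx : x ∈ stdSimplex ℝ (Fin d))
    (hy : y ∈ stdSimplex ℝ (Fin d)) : dualityGap A x y ≤ 2 := by
  have := dualityGap_le (fun j => le_of_abs_le (abs_vecMul_le hA hx j))
    (fun i => neg_le_of_abs_le (abs_mulVec_le hA hy i))
  linarith

theorem openSimplex.le_one {d : ℕ} {x : Fin d → ℝ} (hx : x ∈ openSimplex d) (i : Fin d) :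
    x i ≤ 1 := by
  rw [← hx.1.2]
  exact Finset.single_le_sum (fun k _ => (hx.2 k).le) (Finset.mem_univ i)

/-! ### Ratio identities and lower bounds for equilibria -/

namespace IsBarrierEquilibrium

variable {d : ℕ} {g : ℝ} {M : Matrix (Fin d) (Fin d) ℝ} {x y : Fin d → ℝ}

/-- The first-order equations weighted by `z` and summed. All ratio and distance estimates below are
linear combinations of this identity and its column analogue. -/
theorem row_ratio (h : IsBarrierEquilibrium g M x y) {z : Fin d → ℝ} (hz : z ∈ openSimplex d) :
    g * ∑ i, z i / x i = g * d + z ⬝ᵥ (M *ᵥ y) - x ⬝ᵥ (M *ᵥ y) := by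
  have e : ∀ i, g * (z i / x i) = z i * (M *ᵥ y) i + z i * (g * d - x ⬝ᵥ (M *ᵥ y)) := fun i => by
    have : g * (z i / x i) = z i * (g / x i) := by ring
    rw [this]
    linear_combination (-z i) * h.row_eq i
  rw [Finset.mul_sum, Finset.sum_congr rfl fun i _ => e i, Finset.sum_add_distrib,
    ← Finset.sum_mul, hz.1.2]
  simp only [dotProduct]
  ring

theorem col_ratio (h : IsBarrierEquilibrium g M x y) {z : Fin d → ℝ} (hz : z ∈ openSimplex d) :
    g * ∑ j, z j / y j = g * d + x ⬝ᵥ (M *ᵥ y) - x ⬝ᵥ (M *ᵥ z) := by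
  have e : ∀ j, g * (z j / y j) = z j * (x ⬝ᵥ (M *ᵥ y) + g * d) - (x ᵥ* M) j * z j := fun j => by
    have : g * (z j / y j) = z j * (g / y j) := by ring
    rw [this]
    linear_combination z j * h.col_eq j
  rw [Finset.mul_sum, Finset.sum_congr rfl fun i _ => e i, Finset.sum_sub_distrib,
    ← Finset.sum_mul, hz.1.2, Matrix.dotProduct_mulVec x M z]
  simp only [dotProduct]
  ring

/-- The equilibria of one game for two learning rates have a bounded ratio on average. -/
theorem sum_ratio_le (h : IsBarrierEquilibrium g M x y) {g' : ℝ} {x' y' : Fin d → ℝ}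
    (h' : IsBarrierEquilibrium g' M x' y') (hg : 0 < g) (hg' : 0 < g') (hle : g' ≤ g) :
    ∑ i, x' i / x i + ∑ j, y' j / y j ≤ 4 * d := by
  have e1 := h.row_ratio h'.row_mem
  have e2 := h.col_ratio h'.col_mem
  have e3 := h'.row_ratio h.row_mem
  have e4 := h'.col_ratio h.col_mem
  -- Nonnegativity of the reverse ratios bounds the cross term `x' M y - x M y'` by `2 * g' * d ≤ 2
  -- * g * d`, which is all that the forward ratios exceed `2 * g * d` by.
  have p1 : 0 ≤ ∑ i, x i / x' i :=
    Finset.sum_nonneg fun i _ => (div_pos (h.row_mem.2 i) (h'.row_mem.2 i)).le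
  have p2 : 0 ≤ ∑ i, y i / y' i :=
    Finset.sum_nonneg fun i _ => (div_pos (h.col_mem.2 i) (h'.col_mem.2 i)).le
  have hd : (0 : ℝ) ≤ d := Nat.cast_nonneg d
  have p3 := mul_nonneg hg'.le p1
  have p4 := mul_nonneg hg'.le p2
  have p5 := mul_le_mul_of_nonneg_right hle hd
  refine le_of_mul_le_mul_left ?_ hg
  rw [mul_add]
  linarith

/-- Two payoffs differ by at most 2, so the first-order equation gives `g / x i ≤ 2 + g * d`. This
is the minimal exploration that makes every count large. -/
theorem le_row (h : IsBarrierEquilibrium g M x y) (hg : 0 < g) (hM : ∀ a b, |M a b| ≤ 1)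
    (i : Fin d) : g / (2 + g * d) ≤ x i := by
  have h1 := le_of_abs_le (abs_mulVec_le hM h.col_mem.1 i)
  have h2 := neg_le_of_abs_le (abs_dotProduct_le (abs_mulVec_le hM h.col_mem.1) h.row_mem.1)
  have h3 : g / x i ≤ 2 + g * d := by linarith [h.row_eq i]
  rw [div_le_iff₀ (h.row_mem.2 i)] at h3
  rw [div_le_iff₀ (by positivity)]
  linarith

theorem le_col (h : IsBarrierEquilibrium g M x y) (hg : 0 < g) (hM : ∀ a b, |M a b| ≤ 1)
    (j : Fin d) : g / (2 + g * d) ≤ y j := by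
  have h1 := neg_le_of_abs_le (abs_vecMul_le hM h.row_mem.1 j)
  have h2 := le_of_abs_le (abs_dotProduct_le (abs_mulVec_le hM h.col_mem.1) h.row_mem.1)
  have h3 : g / y j ≤ 2 + g * d := by linarith [h.col_eq j]
  rw [div_le_iff₀ (h.col_mem.2 j)] at h3
  rw [div_le_iff₀ (by positivity)]
  linarith

end IsBarrierEquilibrium

/-! ### Stability of equilibria and absorption of the noise -/

/-- The squared distance of two positive vectors in the local norms of the log-barrier. -/
noncomputable def barrierDist {d : ℕ} (x u : Fin d → ℝ) : ℝ :=
  ∑ i, (x i - u i) ^ 2 / (x i * u i)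

theorem barrierDist_eq {d : ℕ} {x u : Fin d → ℝ} (hx : ∀ i, 0 < x i) (hu : ∀ i, 0 < u i) :
    barrierDist x u = ∑ i, x i / u i + ∑ i, u i / x i - 2 * d := by
  have : ∀ i, (x i - u i) ^ 2 / (x i * u i) = x i / u i + u i / x i - 2 := fun i => by
    have h1 := (hx i).ne'
    have h2 := (hu i).ne'
    field_simp
    ring
  simp only [barrierDist, this, Finset.sum_sub_distrib, Finset.sum_add_distrib]
  simp [mul_comm]

theorem barrierDist_nonneg {d : ℕ} {x u : Fin d → ℝ} (hx : ∀ i, 0 < x i) (hu : ∀ i, 0 < u i) :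
    0 ≤ barrierDist x u :=
  Finset.sum_nonneg fun i _ => by
    have h1 := hx i
    have h2 := hu i
    positivity

/-- For the ratio `ρ = x i / u i` each summand is `ρ + 1/ρ - 2`, and this is at most `1/2` exactly
for `ρ` between `1/2` and 2. -/
theorem le_two_mul_of_barrierDist_le {d : ℕ} {x u : Fin d → ℝ} (hx : ∀ i, 0 < x i)
    (hu : ∀ i, 0 < u i) (h : barrierDist x u ≤ 1 / 2) (i : Fin d) :
    x i ≤ 2 * u i ∧ u i ≤ 2 * x i := by
  have h1 : (x i - u i) ^ 2 / (x i * u i) ≤ 1 / 2 :=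
    (Finset.single_le_sum (f := fun i => (x i - u i) ^ 2 / (x i * u i)) (fun k _ => by
      have h1 := hx k
      have h2 := hu k
      positivity) (Finset.mem_univ i)).trans h
  have h3 := hx i
  have h4 := hu i
  rw [div_le_iff₀ (mul_pos h3 h4)] at h1
  constructor <;> by_contra hcon <;> push Not at hcon <;> nlinarith

/-- The distance is the symmetrized Bregman divergence of the barrier. In the sum of the four ratio
identities the equilibrium values cancel and only the perturbation of the game survives. -/
theorem IsBarrierEquilibrium.mul_barrierDist {d : ℕ} {g : ℝ} {M A : Matrix (Fin d) (Fin d) ℝ}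
    {x y u w : Fin d → ℝ} (h : IsBarrierEquilibrium g M x y) (h' : IsBarrierEquilibrium g A u w) :
    g * (barrierDist x u + barrierDist y w) = u ⬝ᵥ ((M - A) *ᵥ y) - x ⬝ᵥ ((M - A) *ᵥ w) := by
  rw [barrierDist_eq h.row_mem.2 h'.row_mem.2, barrierDist_eq h.col_mem.2 h'.col_mem.2]
  have e1 := h.row_ratio h'.row_mem
  have e2 := h.col_ratio h'.col_mem
  have e3 := h'.row_ratio h.row_mem
  have e4 := h'.col_ratio h.col_mem
  simp only [Matrix.sub_mulVec, dotProduct_sub]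
  linarith

theorem abs_bilinear_le {d : ℕ} {D : Matrix (Fin d) (Fin d) ℝ} {ε : ℝ} {p q : Fin d → ℝ}
    (hD : ∀ i j, |D i j| ≤ ε / (√(p i) * √(q j))) (u w : Fin d → ℝ) :
    |u ⬝ᵥ (D *ᵥ w)| ≤ ε * ((∑ i, |u i| / √(p i)) * ∑ j, |w j| / √(q j)) := by
  calc |u ⬝ᵥ (D *ᵥ w)| = |∑ i, ∑ j, u i * (D i j * w j)| := by
        simp only [dotProduct, Matrix.mulVec, Finset.mul_sum]
    _ ≤ ∑ i, ∑ j, |u i * (D i j * w j)| :=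
        (Finset.abs_sum_le_sum_abs _ _).trans
          (Finset.sum_le_sum fun i _ => Finset.abs_sum_le_sum_abs _ _)
    _ ≤ ∑ i, ∑ j, |u i| * (ε / (√(p i) * √(q j)) * |w j|) := by
        refine Finset.sum_le_sum fun i _ => Finset.sum_le_sum fun j _ => ?_
        rw [abs_mul, abs_mul]
        exact mul_le_mul_of_nonneg_left
          (mul_le_mul_of_nonneg_right (hD i j) (abs_nonneg _)) (abs_nonneg _)
    _ = _ := by
        rw [Finset.sum_mul_sum, Finset.mul_sum]
        refine Finset.sum_congr rfl fun i _ => ?_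
        rw [Finset.mul_sum]
        refine Finset.sum_congr rfl fun j _ => ?_
        rw [div_mul_eq_div_div]
        ring

theorem sum_div_sqrt_le {d : ℕ} {u p : Fin d → ℝ} (hu : u ∈ openSimplex d) (hp : ∀ i, 0 < p i) :
    ∑ i, |u i| / √(p i) ≤ √(∑ i, u i / p i) := by
  have h := Real.sum_mul_le_sqrt_mul_sqrt Finset.univ (fun i => √(u i)) (fun i => √(u i) / √(p i))
  have e1 : ∀ i, √(u i) ^ 2 = u i := fun i => Real.sq_sqrt (hu.2 i).le
  have e2 : ∀ i, (√(u i) / √(p i)) ^ 2 = u i / p i := fun i => by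
    rw [div_pow, e1, Real.sq_sqrt (hp i).le]
  have e3 : ∀ i, √(u i) * (√(u i) / √(p i)) = |u i| / √(p i) := fun i => by
    rw [← mul_div_assoc, ← pow_two, e1, abs_of_pos (hu.2 i)]
  simp only [e1, e2, e3, hu.1.2, Real.sqrt_one, one_mul] at h
  exact h

/-- Cauchy-Schwarz with the weights `√(x i * u i)` of the local norm; `x i ≤ 1` then leaves only the
ratio of `u` to `p`. -/
theorem sum_abs_sub_div_sqrt_le {d : ℕ} {x u p : Fin d → ℝ} (hx : x ∈ openSimplex d)
    (hu : u ∈ openSimplex d) (hp : ∀ i, 0 < p i) :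
    ∑ i, |(x - u) i| / √(p i) ≤ √(barrierDist x u) * √(∑ i, u i / p i) := by
  have h := Real.sum_mul_le_sqrt_mul_sqrt Finset.univ
    (fun i => |x i - u i| / √(x i * u i)) (fun i => √(x i * u i) / √(p i))
  have hxu : ∀ i, 0 < x i * u i := fun i => mul_pos (hx.2 i) (hu.2 i)
  have e1 : ∀ i, (|x i - u i| / √(x i * u i)) ^ 2 = (x i - u i) ^ 2 / (x i * u i) := fun i => by
    rw [div_pow, sq_abs, Real.sq_sqrt (hxu i).le]
  have e2 : ∀ i, (√(x i * u i) / √(p i)) ^ 2 = x i * u i / p i := fun i => by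
    rw [div_pow, Real.sq_sqrt (hxu i).le, Real.sq_sqrt (hp i).le]
  have e3 : ∀ i, |x i - u i| / √(x i * u i) * (√(x i * u i) / √(p i)) = |(x - u) i| / √(p i) :=
    fun i => by
      rw [div_mul_div_cancel₀ (Real.sqrt_pos.2 (hxu i)).ne']
      rfl
  simp only [e1, e2, e3] at h
  refine h.trans (mul_le_mul_of_nonneg_left (Real.sqrt_le_sqrt ?_) (Real.sqrt_nonneg _))
  refine Finset.sum_le_sum fun i _ => ?_
  have := hp i
  gcongr
  exact mul_le_of_le_one_left (hu.2 i).le (openSimplex.le_one hx i)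

theorem sqrt_mul_sqrt_le_of_add_le {a b c : ℝ} (ha : 0 ≤ a) (hb : 0 ≤ b) (h : a + b ≤ 2 * c) :
    √a * √b ≤ c := by
  nlinarith [sq_nonneg (√a - √b), Real.sq_sqrt ha, Real.sq_sqrt hb]

namespace IsBarrierEquilibrium

variable {d : ℕ} {g : ℝ} {M A : Matrix (Fin d) (Fin d) ℝ} {x y u w p q : Fin d → ℝ}

/-- Stability of the equilibrium under a perturbation of the game that is small relative to the
sampling probabilities of nearby strategies. -/
theorem barrierDist_le [NeZero d] (h : IsBarrierEquilibrium g M x y) (h' : IsBarrierEquilibrium g A u w)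
    (hg : 0 < g) (hp : ∀ i, 0 < p i) (hq : ∀ j, 0 < q j)
    (hD : ∀ i j, |(M - A) i j| ≤ g / (16 * d) / (√(p i) * √(q j)))
    (hK : ∑ i, u i / p i + ∑ j, w j / q j ≤ 8 * d) :
    barrierDist x u + barrierDist y w ≤ 1 / 2 := by
  have hd : (0 : ℝ) < d := Nat.cast_pos.2 (NeZero.pos d)
  have e := h.mul_barrierDist h'
  -- Inserting `u (M - A) w` makes each term linear in a displacement, hence of order `√X` or `√Y`.
  -- The inequality for `X + Y` then becomes self-bounding.
  have e' : u ⬝ᵥ ((M - A) *ᵥ y) - x ⬝ᵥ ((M - A) *ᵥ w) =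
      u ⬝ᵥ ((M - A) *ᵥ (y - w)) - (x - u) ⬝ᵥ ((M - A) *ᵥ w) := by
    simp only [Matrix.mulVec_sub, dotProduct_sub, sub_dotProduct]
    ring
  have hKx : 0 ≤ ∑ i, u i / p i :=
    Finset.sum_nonneg fun i _ => (div_pos (h'.row_mem.2 i) (hp i)).le
  have hKy : 0 ≤ ∑ i, w i / q i :=
    Finset.sum_nonneg fun i _ => (div_pos (h'.col_mem.2 i) (hq i)).le
  have hKK := sqrt_mul_sqrt_le_of_add_le (c := 4 * d) hKx hKy (by linarith)
  set X := barrierDist x u with hX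
  set Y := barrierDist y w with hY
  have hX0 : 0 ≤ X := barrierDist_nonneg h.row_mem.2 h'.row_mem.2
  have hY0 : 0 ≤ Y := barrierDist_nonneg h.col_mem.2 h'.col_mem.2
  have n1 : ∀ (v r : Fin d → ℝ), 0 ≤ ∑ i, |v i| / √(r i) := fun v r =>
    Finset.sum_nonneg fun i _ => by positivity
  have b1 : |u ⬝ᵥ ((M - A) *ᵥ (y - w))| ≤ g / (16 * d) * (4 * d * √Y) := by
    refine (abs_bilinear_le hD _ _).trans (mul_le_mul_of_nonneg_left ?_ (by positivity))
    calc _ ≤ √(∑ i, u i / p i) * (√Y * √(∑ j, w j / q j)) :=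
          mul_le_mul (sum_div_sqrt_le h'.row_mem hp)
            (sum_abs_sub_div_sqrt_le h.col_mem h'.col_mem hq) (n1 _ _) (Real.sqrt_nonneg _)
      _ = √(∑ i, u i / p i) * √(∑ j, w j / q j) * √Y := by ring
      _ ≤ _ := mul_le_mul_of_nonneg_right hKK (Real.sqrt_nonneg _)
  have b2 : |(x - u) ⬝ᵥ ((M - A) *ᵥ w)| ≤ g / (16 * d) * (4 * d * √X) := by
    refine (abs_bilinear_le hD _ _).trans (mul_le_mul_of_nonneg_left ?_ (by positivity))
    calc _ ≤ (√X * √(∑ i, u i / p i)) * √(∑ j, w j / q j) :=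
          mul_le_mul (sum_abs_sub_div_sqrt_le h.row_mem h'.row_mem hp)
            (sum_div_sqrt_le h'.col_mem hq) (n1 _ _) (by positivity)
      _ = √(∑ i, u i / p i) * √(∑ j, w j / q j) * √X := by ring
      _ ≤ _ := mul_le_mul_of_nonneg_right hKK (Real.sqrt_nonneg _)
  have b3 : g * (X + Y) ≤ g * ((√X + √Y) / 4) := by
    rw [e, e']
    have : g / (16 * d) * (4 * d * √Y) + g / (16 * d) * (4 * d * √X) = g * ((√X + √Y) / 4) := by
      field_simp
      ring
    linarith [le_of_abs_le b1, neg_le_of_abs_le b2]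
  have b4 := le_of_mul_le_mul_left b3 hg
  nlinarith [Real.sq_sqrt hX0, Real.sq_sqrt hY0, sq_nonneg (√X - √Y), Real.sqrt_nonneg X,
    Real.sqrt_nonneg Y, sq_nonneg (√X - 1/2), sq_nonneg (√Y - 1/2)]

/-- The right side of the distance identity is at most 4 for any two bounded games, so a rate of 8
suffices without any accuracy. This starts the induction. -/
theorem barrierDist_le_of_eight_le (h : IsBarrierEquilibrium g M x y)
    (h' : IsBarrierEquilibrium g A u w) (hg : 8 ≤ g) (hM : ∀ a b, |M a b| ≤ 1)
    (hA : ∀ a b, |A a b| ≤ 1) : barrierDist x u + barrierDist y w ≤ 1 / 2 := by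
  have hD : ∀ a b, |(M - A) a b| ≤ 2 := fun a b => by
    rw [Matrix.sub_apply]
    exact (abs_sub _ _).trans (by linarith [hM a b, hA a b])
  have e := h.mul_barrierDist h'
  have b1 := le_of_abs_le (abs_dotProduct_le (abs_mulVec_le hD h.col_mem.1) h'.row_mem.1)
  have b2 := neg_le_of_abs_le (abs_dotProduct_le (abs_mulVec_le hD h'.col_mem.1) h.row_mem.1)
  have hX0 : 0 ≤ barrierDist x u := barrierDist_nonneg h.row_mem.2 h'.row_mem.2
  have hY0 : 0 ≤ barrierDist y w := barrierDist_nonneg h.col_mem.2 h'.col_mem.2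
  nlinarith [mul_le_mul_of_nonneg_right hg (add_nonneg hX0 hY0)]

/-- Each of the two ratio bounds contributes a factor `√(16 * d)`, and their product cancels the `16
* d` in the accuracy. -/
theorem row_noise_le [NeZero d] (hg : 0 < g) (hx : x ∈ openSimplex d) (hy : y ∈ openSimplex d)
    (hp : ∀ i, 0 < p i) (hq : ∀ j, 0 < q j) {D : Matrix (Fin d) (Fin d) ℝ}
    (hD : ∀ i j, |D i j| ≤ g / (16 * d) / (√(p i) * √(q j)))
    (hx' : ∑ i, x i / p i ≤ 16 * d) (hy' : ∑ j, y j / q j ≤ 16 * d) (i : Fin d) :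
    |(D *ᵥ y) i| ≤ g / √(x i) := by
  have hd : (0 : ℝ) < d := Nat.cast_pos.2 (NeZero.pos d)
  have h1 := abs_bilinear_le hD (Pi.single i 1) y
  have e1 : ∑ k, |(Pi.single i 1 : Fin d → ℝ) k| / √(p k) = 1 / √(p i) := by
    rw [Finset.sum_eq_single i]
    · simp
    · intro k _ hk; simp [Pi.single_eq_of_ne hk]
    · simp
  rw [single_one_dotProduct, e1] at h1
  have h2 : ∑ j, |y j| / √(q j) ≤ √(16 * d) := (sum_div_sqrt_le hy hq).trans (Real.sqrt_le_sqrt hy')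
  have h3 : 1 / √(p i) ≤ √(16 * d) / √(x i) := by
    have : x i / p i ≤ 16 * d := (Finset.single_le_sum (f := fun i => x i / p i)
      (fun k _ => (div_pos (hx.2 k) (hp k)).le) (Finset.mem_univ i)).trans hx'
    rw [div_le_iff₀ (hp i)] at this
    rw [div_le_div_iff₀ (Real.sqrt_pos.2 (hp i)) (Real.sqrt_pos.2 (hx.2 i)), one_mul,
      ← Real.sqrt_mul (by positivity)]
    exact Real.sqrt_le_sqrt this
  calc _ ≤ _ := h1
    _ ≤ g / (16 * d) * (√(16 * d) / √(x i) * √(16 * d)) := by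
        refine mul_le_mul_of_nonneg_left (mul_le_mul h3 h2 ?_ (by positivity)) (by positivity)
        exact Finset.sum_nonneg fun i _ => by positivity
    _ = g / (16 * d) * (√(16 * d) ^ 2) / √(x i) := by ring
    _ = g / √(x i) := by
        rw [Real.sq_sqrt (by positivity)]
        field_simp

theorem barrier_absorbs (hg : 0 < g) {a : ℝ} (ha : 0 < a) : g / √a - g / a ≤ g / 2 := by
  have h : g / a = g * (1 / √a) ^ 2 := by
    rw [div_pow, Real.sq_sqrt ha.le]
    ring
  rw [h, ← mul_one_div]
  nlinarith [mul_nonneg hg.le (sq_nonneg (1 / √a - 1 / 2))]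

theorem dualityGap_le_of_noise [NeZero d] (h : IsBarrierEquilibrium g M x y) (hg : 0 < g)
    (hp : ∀ i, 0 < p i) (hq : ∀ j, 0 < q j)
    (hD : ∀ i j, |(M - A) i j| ≤ g / (16 * d) / (√(p i) * √(q j)))
    (hx' : ∑ i, x i / p i ≤ 16 * d) (hy' : ∑ j, y j / q j ≤ 16 * d) :
    dualityGap A x y ≤ 3 * g * d := by
  have hd : (1 : ℝ) ≤ d := Nat.one_le_cast.2 (NeZero.pos d)
  have hr := row_noise_le hg h.row_mem h.col_mem hp hq hD hx' hy'
  -- The column error is the row error of the transposed game with the players exchanged.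
  have hc := row_noise_le hg h.col_mem h.row_mem hq hp (D := (M - A)ᵀ)
    (fun i j => by rw [mul_comm (√(q i))]; exact hD j i) hy' hx'
  have hgap : dualityGap A x y ≤ (x ⬝ᵥ (M *ᵥ y) + g * d + g / 2) -
      (x ⬝ᵥ (M *ᵥ y) - g * d - g / 2) := by
    refine dualityGap_le (fun j => ?_) fun i => ?_
    · have h1 := neg_le_of_abs_le (hc j)
      rw [Matrix.mulVec_transpose, Matrix.vecMul_sub, Pi.sub_apply, h.col_eq j] at h1
      linarith [barrier_absorbs hg (h.col_mem.2 j)]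
    · have h1 := le_of_abs_le (hr i)
      rw [Matrix.sub_mulVec, Pi.sub_apply, h.row_eq i] at h1
      linarith [barrier_absorbs hg (h.row_mem.2 i)]
  nlinarith

end IsBarrierEquilibrium

/-! ### Induction over the epochs -/

/-- The strategies stay close to the equilibria of the true game, and their duality gap is bounded
by the learning rate, as long as the estimates are accurate relative to the sampling
probabilities. -/
theorem dualityGap_strategies_le {d : ℕ} [NeZero d] {A : Matrix (Fin d) (Fin d) ℝ}
    (hA : ∀ a b, |A a b| ≤ 1) {g : ℕ → ℝ} (hg : ∀ s, 1 ≤ s → 0 < g s) (hg1 : 8 ≤ g 1)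
    (hanti : ∀ s, 1 ≤ s → g (s + 1) ≤ g s) {M : ℕ → Matrix (Fin d) (Fin d) ℝ}
    (hM : ∀ s a b, |M s a b| ≤ 1)
    (hacc : ∀ s, 1 ≤ s → g (s + 1) < 8 → ∀ a b, |(M (s + 1) - A) a b| ≤
      g (s + 1) / (16 * d) / (√(rowStrategy (g s) (M s) a) * √(colStrategy (g s) (M s) b)))
    {s : ℕ} (hs : 1 ≤ s) :
    dualityGap A (rowStrategy (g s) (M s)) (colStrategy (g s) (M s)) ≤ 3 * g s * d := by
  have hd : (1 : ℝ) ≤ d := Nat.one_le_cast.2 (NeZero.pos d)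
  have heq := fun s hs => isBarrierEquilibrium_strategies (hg s hs) (M s)
  have hst := fun s hs => isBarrierEquilibrium_strategies (hg s hs) A
  have hcrude : ∀ s, 1 ≤ s → 8 ≤ g s →
      dualityGap A (rowStrategy (g s) (M s)) (colStrategy (g s) (M s)) ≤ 3 * g s * d := by
    intro s hs h8
    have := dualityGap_le_two hA (heq s hs).row_mem.1 (heq s hs).col_mem.1
    nlinarith
  -- The gap bound alone does not propagate; closeness to the true equilibrium with the same rate is
  -- carried along.
  suffices H : barrierDist (rowStrategy (g s) (M s)) (rowStrategy (g s) A) +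
      barrierDist (colStrategy (g s) (M s)) (colStrategy (g s) A) ≤ 1 / 2 ∧
      dualityGap A (rowStrategy (g s) (M s)) (colStrategy (g s) (M s)) ≤ 3 * g s * d from H.2
  induction s, hs using Nat.le_induction with
  | base => exact ⟨(heq 1 le_rfl).barrierDist_le_of_eight_le (hst 1 le_rfl) hg1 (hM 1) hA,
      hcrude 1 le_rfl hg1⟩
  | succ s hs ih =>
    have hs1 : 1 ≤ s + 1 := by omega
    by_cases h8 : 8 ≤ g (s + 1)
    · exact ⟨(heq _ hs1).barrierDist_le_of_eight_le (hst _ hs1) h8 (hM _) hA, hcrude _ hs1 h8⟩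
    have hD := hacc s hs (not_le.1 h8)
    have ratio : ∀ {x u p : Fin d → ℝ}, (∀ i, 0 < x i) → (∀ i, 0 < u i) → (∀ i, 0 < p i) →
        (∀ i, u i ≤ 2 * p i) → ∑ i, x i / p i ≤ 2 * ∑ i, x i / u i := by
      intro x u p hx hu hp hup
      rw [Finset.mul_sum]
      refine Finset.sum_le_sum fun i _ => ?_
      rw [← mul_div_assoc, div_le_div_iff₀ (hp i) (hu i)]
      nlinarith [mul_le_mul_of_nonneg_left (hup i) (hx i).le]
    have ratio' : ∀ {x u p : Fin d → ℝ}, (∀ i, 0 < p i) →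
        (∀ i, x i ≤ 2 * u i) → ∑ i, x i / p i ≤ 2 * ∑ i, u i / p i := by
      intro x u p hp hxu
      rw [Finset.mul_sum]
      refine Finset.sum_le_sum fun i _ => ?_
      rw [← mul_div_assoc]
      exact div_le_div_of_nonneg_right (hxu i) (hp i).le
    have E := heq s hs
    have E' := heq (s + 1) hs1
    have S := hst s hs
    have S' := hst (s + 1) hs1
    have hX0 := barrierDist_nonneg E.row_mem.2 S.row_mem.2
    have hY0 := barrierDist_nonneg E.col_mem.2 S.col_mem.2
    have hsum := S.sum_ratio_le S' (hg s hs) (hg _ hs1) (hanti s hs)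
    -- Passing from the old true equilibrium to the old played pair costs a factor 2 in the ratio `4
    -- * d`. After `hdist`, passing to the new played pair costs another, giving `16 * d`.
    have r1 := ratio S'.row_mem.2 S.row_mem.2 E.row_mem.2 fun i =>
      (le_two_mul_of_barrierDist_le E.row_mem.2 S.row_mem.2 (by linarith [ih.1]) i).2
    have r2 := ratio S'.col_mem.2 S.col_mem.2 E.col_mem.2 fun i =>
      (le_two_mul_of_barrierDist_le E.col_mem.2 S.col_mem.2 (by linarith [ih.1]) i).2
    have hdist := E'.barrierDist_le S' (hg _ hs1) E.row_mem.2 E.col_mem.2 hD (by linarith)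
    refine ⟨hdist, ?_⟩
    have hX1 := barrierDist_nonneg E'.row_mem.2 S'.row_mem.2
    have hY1 := barrierDist_nonneg E'.col_mem.2 S'.col_mem.2
    have n1 : 0 ≤ ∑ i, rowStrategy (g (s + 1)) A i / rowStrategy (g s) (M s) i :=
      Finset.sum_nonneg fun i _ => (div_pos (S'.row_mem.2 i) (E.row_mem.2 i)).le
    have n2 : 0 ≤ ∑ i, colStrategy (g (s + 1)) A i / colStrategy (g s) (M s) i :=
      Finset.sum_nonneg fun i _ => (div_pos (S'.col_mem.2 i) (E.col_mem.2 i)).le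
    have r3 := ratio' E.row_mem.2 fun i =>
      (le_two_mul_of_barrierDist_le E'.row_mem.2 S'.row_mem.2 (by linarith) i).1
    have r4 := ratio' E.col_mem.2 fun i =>
      (le_two_mul_of_barrierDist_le E'.col_mem.2 S'.col_mem.2 (by linarith) i).1
    exact E'.dualityGap_le_of_noise (hg _ hs1) E.row_mem.2 E.col_mem.2 hD (by linarith)
      (by linarith)

/-! ### Exponential supermartingales -/

/-- A random variable that is bounded almost everywhere. -/
def AEBounded {Ω : Type*} {mΩ : MeasurableSpace Ω} (μ : Measure Ω) (f : Ω → ℝ) : Prop :=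
  ∃ B : ℝ, ∀ᵐ ω ∂μ, |f ω| ≤ B

namespace AEBounded

variable {Ω : Type*} {mΩ : MeasurableSpace Ω} {μ : Measure Ω} {f h : Ω → ℝ}

theorem add (hf : AEBounded μ f) (hh : AEBounded μ h) : AEBounded μ fun ω => f ω + h ω := by
  obtain ⟨B, hB⟩ := hf
  obtain ⟨C, hC⟩ := hh
  refine ⟨B + C, ?_⟩
  filter_upwards [hB, hC] with ω h1 h2 using (abs_add_le _ _).trans (add_le_add h1 h2)

theorem neg (hf : AEBounded μ f) : AEBounded μ fun ω => -f ω := by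
  obtain ⟨B, hB⟩ := hf
  exact ⟨B, by simpa using hB⟩

theorem sub (hf : AEBounded μ f) (hh : AEBounded μ h) : AEBounded μ fun ω => f ω - h ω := by
  simpa only [sub_eq_add_neg] using hf.add hh.neg

theorem mul (hf : AEBounded μ f) (hh : AEBounded μ h) : AEBounded μ fun ω => f ω * h ω := by
  obtain ⟨B, hB⟩ := hf
  obtain ⟨C, hC⟩ := hh
  refine ⟨B * C, ?_⟩
  filter_upwards [hB, hC] with ω h1 h2
  rw [abs_mul]
  exact mul_le_mul h1 h2 (abs_nonneg _) ((abs_nonneg _).trans h1)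

theorem const (c : ℝ) : AEBounded μ fun _ => c := ⟨|c|, Filter.Eventually.of_forall fun _ => le_rfl⟩

theorem exp (hf : AEBounded μ f) : AEBounded μ fun ω => Real.exp (f ω) := by
  obtain ⟨B, hB⟩ := hf
  refine ⟨Real.exp B, ?_⟩
  filter_upwards [hB] with ω h1
  rw [abs_of_pos (Real.exp_pos _)]
  exact Real.exp_le_exp.2 (le_of_abs_le h1)

theorem sum {ι : Type*} {F : ι → Ω → ℝ} (s : Finset ι) (hF : ∀ k ∈ s, AEBounded μ (F k)) :
    AEBounded μ fun ω => ∑ k ∈ s, F k ω := by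
  classical
  induction s using Finset.induction_on with
  | empty => simpa using const (μ := μ) 0
  | insert k s hk ih =>
    simp only [Finset.sum_insert hk]
    exact (hF k (Finset.mem_insert_self k s)).add
      (ih fun l hl => hF l (Finset.mem_insert_of_mem hl))

theorem integrable [IsFiniteMeasure μ] (hf : AEBounded μ f) (hm : Measurable f) :
    Integrable f μ := by
  obtain ⟨B, hB⟩ := hf
  exact Integrable.of_bound hm.aestronglyMeasurable B hB

end AEBounded

section Supermartingale

variable {Ω : Type*} {mΩ : MeasurableSpace Ω} {μ : Measure Ω} [IsProbabilityMeasure μ]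

theorem integral_mul_condExp {m : MeasurableSpace Ω} (hm : m ≤ mΩ) {W X q : Ω → ℝ}
    (hW : Measurable[m] W) (hWb : AEBounded μ W) (hX : Measurable[mΩ] X) (hXb : AEBounded μ X)
    (hq : μ[X | m] =ᵐ[μ] q) : ∫ ω, W ω * X ω ∂μ = ∫ ω, W ω * q ω ∂μ := by
  have h1 : μ[W * X | m] =ᵐ[μ] W * μ[X | m] :=
    condExp_mul_of_stronglyMeasurable_left hW.stronglyMeasurable
      ((hWb.mul hXb).integrable ((hW.mono hm le_rfl).mul hX)) (hXb.integrable hX)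
  calc ∫ ω, W ω * X ω ∂μ = ∫ ω, (μ[W * X | m]) ω ∂μ := (integral_condExp hm).symm
    _ = ∫ ω, W ω * q ω ∂μ := by
      refine integral_congr_ae ?_
      filter_upwards [h1, hq] with ω e1 e2
      rw [e1, Pi.mul_apply, e2]

/-- If each exponential increment has conditional mean at most one, then so has the exponential
of the sum. -/
theorem integral_exp_sum_le_one {ℱ : ℕ → MeasurableSpace Ω} {a : ℕ}
    {D : ℕ → Ω → ℝ} (hD : ∀ t k, a ≤ t → t < k → Measurable[ℱ k] (D t))
    {b : ℕ} (hDb : ∀ t, a ≤ t → t < b → AEBounded μ (D t))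
    (hstep : ∀ t, a ≤ t → t < b → ∀ W : Ω → ℝ, Measurable[ℱ t] W → (∀ ω, 0 ≤ W ω) → AEBounded μ W →
      ∫ ω, W ω * Real.exp (D t ω) ∂μ ≤ ∫ ω, W ω ∂μ) (hab : a ≤ b) :
    ∫ ω, Real.exp (∑ t ∈ Finset.Ico a b, D t ω) ∂μ ≤ 1 := by
  induction b, hab using Nat.le_induction with
  | base => simp
  | succ b hab ih =>
    have hb := fun t (ht : t ∈ Finset.Ico a b) =>
      hDb t (Finset.mem_Ico.1 ht).1 ((Finset.mem_Ico.1 ht).2.trans b.lt_succ_self)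
    have h := hstep b hab b.lt_succ_self (fun ω => Real.exp (∑ t ∈ Finset.Ico a b, D t ω))
      (Real.measurable_exp.comp (Finset.measurable_sum _ fun t ht =>
        hD t b (Finset.mem_Ico.1 ht).1 (Finset.mem_Ico.1 ht).2))
      (fun ω => (Real.exp_pos _).le) (AEBounded.sum _ hb).exp
    simp only [Finset.sum_Ico_succ_top hab, Real.exp_add]
    exact h.trans (ih (fun t h1 h2 => hDb t h1 (h2.trans b.lt_succ_self))
      fun t h1 h2 => hstep t h1 (h2.trans b.lt_succ_self))

/-- The deviation inequality for an exponential supermartingale. -/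
theorem measure_le_sum_le {ℱ : ℕ → MeasurableSpace Ω} {a : ℕ} (hℱ : ∀ t, a ≤ t → ℱ t ≤ mΩ)
    {D : ℕ → Ω → ℝ} (hD : ∀ t k, a ≤ t → t < k → Measurable[ℱ k] (D t))
    {b : ℕ} (hDb : ∀ t, a ≤ t → t < b → AEBounded μ (D t))
    (hstep : ∀ t, a ≤ t → t < b → ∀ W : Ω → ℝ, Measurable[ℱ t] W → (∀ ω, 0 ≤ W ω) → AEBounded μ W →
      ∫ ω, W ω * Real.exp (D t ω) ∂μ ≤ ∫ ω, W ω ∂μ) (hab : a ≤ b) (l : ℝ) :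
    MeasurableSet {ω | l ≤ ∑ t ∈ Finset.Ico a b, D t ω} ∧
      μ {ω | l ≤ ∑ t ∈ Finset.Ico a b, D t ω} ≤ ENNReal.ofReal (Real.exp (-l)) := by
  have hm : Measurable fun ω => ∑ t ∈ Finset.Ico a b, D t ω :=
    Finset.measurable_sum _ fun t ht => (hD t (t + 1) (Finset.mem_Ico.1 ht).1 t.lt_succ_self).mono
      (hℱ _ ((Finset.mem_Ico.1 ht).1.trans t.le_succ)) le_rfl
  refine ⟨measurableSet_le measurable_const hm, ?_⟩
  have h1 := mul_meas_ge_le_integral_of_nonneg (μ := μ)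
    (f := fun ω => Real.exp (∑ t ∈ Finset.Ico a b, D t ω))
    (Filter.Eventually.of_forall fun ω => (Real.exp_pos _).le)
    ((AEBounded.sum _ fun t ht => hDb t (Finset.mem_Ico.1 ht).1 (Finset.mem_Ico.1 ht).2).exp.integrable
      (Real.measurable_exp.comp hm)) (Real.exp l)
  have h2 := h1.trans (integral_exp_sum_le_one hD hDb hstep hab)
  simp only [Real.exp_le_exp] at h2
  rw [← ofReal_measureReal]
  refine ENNReal.ofReal_le_ofReal ?_
  rw [Real.exp_neg, ← one_div, le_div_iff₀ (Real.exp_pos l), mul_comm]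
  exact h2

/-- The exponential increment of the number of successes. -/
theorem integral_mul_exp_count_le {m : MeasurableSpace Ω} (hm : m ≤ mΩ) {W X q : Ω → ℝ}
    (hX : Measurable[mΩ] X) (hX01 : ∀ ω, X ω = 0 ∨ X ω = 1)
    (hq : Measurable[m] q) (hqb : AEBounded μ q) (hXq : μ[X | m] =ᵐ[μ] q)
    (hW : Measurable[m] W) (hW0 : ∀ ω, 0 ≤ W ω) (hWb : AEBounded μ W) :
    ∫ ω, W ω * Real.exp (5 / 8 * q ω - X ω) ∂μ ≤ ∫ ω, W ω ∂μ := by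
  have hXb : AEBounded μ X := ⟨1, Filter.Eventually.of_forall fun ω => by
    rcases hX01 ω with h | h <;> simp [h]⟩
  have hq' := hq.mono hm le_rfl
  have hW' := hW.mono hm le_rfl
  set V : Ω → ℝ := fun ω => W ω * Real.exp (5 / 8 * q ω) with hV
  have hVm : Measurable[m] V := hW.mul (Real.measurable_exp.comp (hq.const_mul (5 / 8)))
  have hVb : AEBounded μ V := hWb.mul ((AEBounded.const (5 / 8)).mul hqb).exp
  have hV' := hVm.mono hm le_rfl
  have hV0 : ∀ ω, 0 ≤ V ω := fun ω => mul_nonneg (hW0 ω) (Real.exp_pos _).le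
  calc ∫ ω, W ω * Real.exp (5 / 8 * q ω - X ω) ∂μ
      ≤ ∫ ω, (V ω - 5 / 8 * (V ω * X ω)) ∂μ := by
        refine integral_mono ((hWb.mul (((AEBounded.const (5 / 8)).mul hqb).sub hXb).exp).integrable
            (by fun_prop))
          ((hVb.sub ((AEBounded.const (5 / 8)).mul (hVb.mul hXb))).integrable (by fun_prop))
          fun ω => ?_
        -- For `X` in `{0, 1}` this only needs `exp (-1) ≤ 3 / 8`, which is the origin of the
        -- constant `5 / 8`.
        have h1 : Real.exp (-X ω) ≤ 1 - 5 / 8 * X ω := by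
          rcases hX01 ω with h | h
          · simp [h]
          · rw [h]
            linarith [Real.exp_neg_one_lt_d9]
        have := mul_le_mul_of_nonneg_left h1 (hV0 ω)
        simp only [sub_eq_add_neg, Real.exp_add, hV] at this ⊢
        linarith
    _ = ∫ ω, (V ω - 5 / 8 * (V ω * q ω)) ∂μ := by
        rw [integral_sub (hVb.integrable hV')
            (((AEBounded.const (5 / 8)).mul (hVb.mul hXb)).integrable (by fun_prop)),
          integral_sub (hVb.integrable hV')
            (((AEBounded.const (5 / 8)).mul (hVb.mul hqb)).integrable (by fun_prop)),
          integral_const_mul, integral_const_mul, integral_mul_condExp hm hVm hVb hX hXb hXq]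
    _ ≤ ∫ ω, W ω ∂μ := by
        refine integral_mono
          ((hVb.sub ((AEBounded.const (5 / 8)).mul (hVb.mul hqb))).integrable (by fun_prop))
          (hWb.integrable hW') fun ω => ?_
        have h1 := Real.add_one_le_exp (-(5 / 8 * q ω))
        have h2 := mul_le_mul_of_nonneg_left h1 (hV0 ω)
        have h3 : V ω * Real.exp (-(5 / 8 * q ω)) = W ω := by
          rw [hV, mul_assoc, ← Real.exp_add, add_neg_cancel, Real.exp_zero, mul_one]
        simp only
        linarith

/-- From `exp z ≤ 1 + z + z ^ 2` and `(y - c) ^ 2 = y ^ 2 - c ^ 2 - 2 * c * (y - c) ≤ 1 - 2 * c * (y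
- c)`. The part linear in `y - c` has conditional mean zero, so the variance proxy is 1 rather than
4. -/
theorem exp_mul_le_one_add {X L y c : ℝ} (hX : X = 0 ∨ X = 1) (hL : |L| ≤ 1 / 2) (hy : |y| ≤ 1)
    (hc : |c| ≤ 1) :
    Real.exp (L * (X * (y - c))) ≤ 1 + X * ((L - 2 * c * L ^ 2) * (y - c)) + X * L ^ 2 := by
  rcases hX with rfl | rfl
  · simp
  · have h1 : |L * (y - c)| ≤ 1 := by
      rw [abs_mul]
      have h2 : |y - c| ≤ 2 := (abs_sub _ _).trans (by linarith)
      nlinarith [mul_le_mul hL h2 (abs_nonneg _) (by norm_num)]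
    have h2 := le_of_abs_le (Real.abs_exp_sub_one_sub_id_le h1)
    have h3 : y ^ 2 ≤ 1 := (sq_le_one_iff_abs_le_one y).2 hy
    rw [one_mul]
    nlinarith [mul_nonneg (sq_nonneg L) (sub_nonneg.2 h3), sq_nonneg (L * c)]

/-- The exponential increment of the deviation of the feedback. -/
theorem integral_mul_exp_deviation_le {m m' : MeasurableSpace Ω} (hm : m ≤ m') (hm' : m' ≤ mΩ)
    {W X q r Z L : Ω → ℝ} {c : ℝ} (hc : |c| ≤ 1)
    (hX : Measurable[m'] X) (hX01 : ∀ ω, X ω = 0 ∨ X ω = 1)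
    (hq : Measurable[m] q) (hqb : AEBounded μ q) (hXq : μ[X | m] =ᵐ[μ] q)
    (hr : Measurable[mΩ] r) (hrb : ∀ᵐ ω ∂μ, |r ω| ≤ 1) (hrZ : μ[r | m'] =ᵐ[μ] Z)
    (hXZ : ∀ ω, X ω * Z ω = X ω * c)
    (hL : Measurable[m] L) (hLb : ∀ ω, |L ω| ≤ 1 / 2)
    (hW : Measurable[m] W) (hW0 : ∀ ω, 0 ≤ W ω) (hWb : AEBounded μ W) :
    ∫ ω, W ω * Real.exp (L ω * (X ω * (r ω - c)) - L ω ^ 2 * q ω) ∂μ ≤ ∫ ω, W ω ∂μ := by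
  have hmΩ := hm.trans hm'
  have hXb : AEBounded μ X := ⟨1, Filter.Eventually.of_forall fun ω => by
    rcases hX01 ω with h | h <;> simp [h]⟩
  have hrb' : AEBounded μ r := ⟨1, hrb⟩
  have hLb' : AEBounded μ L := ⟨1 / 2, Filter.Eventually.of_forall hLb⟩
  have hL2b : AEBounded μ fun ω => L ω ^ 2 := by simpa only [pow_two] using hLb'.mul hLb'
  have hX' := hX.mono hm' le_rfl
  have hq' := hq.mono hmΩ le_rfl
  have hW' := hW.mono hmΩ le_rfl
  have hL' := hL.mono hmΩ le_rfl
  set V : Ω → ℝ := fun ω => W ω * Real.exp (-(L ω ^ 2 * q ω)) with hV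
  have hVm : Measurable[m] V :=
    hW.mul (Real.measurable_exp.comp ((hL.pow_const 2).mul hq).neg)
  have hVb : AEBounded μ V := hWb.mul (hL2b.mul hqb).neg.exp
  have hV' := hVm.mono hmΩ le_rfl
  have hV0 : ∀ ω, 0 ≤ V ω := fun ω => mul_nonneg (hW0 ω) (Real.exp_pos _).le
  set U : Ω → ℝ := fun ω => V ω * (L ω - 2 * c * L ω ^ 2) with hU
  have hUm : Measurable[m] U := hVm.mul (hL.sub ((hL.pow_const 2).const_mul (2 * c)))
  have hUb : AEBounded μ U := hVb.mul (hLb'.sub ((AEBounded.const (2 * c)).mul hL2b))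
  have hU' := hUm.mono hmΩ le_rfl
  have hUXm : Measurable[m'] fun ω => U ω * X ω := (hUm.mono hm le_rfl).mul hX
  have hUXb : AEBounded μ fun ω => U ω * X ω := hUb.mul hXb
  -- Conditioning on the actions as well makes `X` known. Where `X` is nonzero, the conditional mean
  -- `Z` of the feedback equals `c`.
  have hmean : ∫ ω, U ω * X ω * (r ω - c) ∂μ = 0 := by
    simp only [mul_sub]
    rw [integral_sub ((hUXb.mul hrb').integrable (by fun_prop))
      ((hUXb.mul (AEBounded.const c)).integrable (by fun_prop)),
      integral_mul_condExp hm' hUXm hUXb hr hrb' hrZ, sub_eq_zero]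
    refine integral_congr_ae (Filter.Eventually.of_forall fun ω => ?_)
    simp only
    linear_combination U ω * hXZ ω
  have hVL : Measurable[m] fun ω => V ω * L ω ^ 2 := hVm.mul (hL.pow_const 2)
  have hVLb : AEBounded μ fun ω => V ω * L ω ^ 2 := hVb.mul hL2b
  have i1 := hVb.integrable hV'
  have i2 : Integrable (fun ω => U ω * X ω * (r ω - c)) μ :=
    (hUXb.mul (hrb'.sub (AEBounded.const c))).integrable (by fun_prop)
  have i3 : Integrable (fun ω => V ω * L ω ^ 2 * X ω) μ := (hVLb.mul hXb).integrable (by fun_prop)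
  have i4 : Integrable (fun ω => V ω * L ω ^ 2 * q ω) μ := (hVLb.mul hqb).integrable (by fun_prop)
  have i5 : Integrable (fun ω => V ω + U ω * X ω * (r ω - c)) μ := i1.add i2
  calc ∫ ω, W ω * Real.exp (L ω * (X ω * (r ω - c)) - L ω ^ 2 * q ω) ∂μ
      ≤ ∫ ω, (V ω + U ω * X ω * (r ω - c) + V ω * L ω ^ 2 * X ω) ∂μ := by
        refine integral_mono_ae ((hWb.mul ((hLb'.mul (hXb.mul
            (hrb'.sub (AEBounded.const c)))).sub (hL2b.mul hqb)).exp).integrable (by fun_prop))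
          (i5.add i3) ?_
        filter_upwards [hrb] with ω hω
        have := mul_le_mul_of_nonneg_left (exp_mul_le_one_add (hX01 ω) (hLb ω) hω hc) (hV0 ω)
        have e : W ω * Real.exp (L ω * (X ω * (r ω - c)) - L ω ^ 2 * q ω) =
            V ω * Real.exp (L ω * (X ω * (r ω - c))) := by
          rw [sub_eq_add_neg, Real.exp_add]
          ring
        rw [e]
        refine this.trans (le_of_eq ?_)
        simp only [hU]
        ring
    _ = ∫ ω, (V ω + V ω * L ω ^ 2 * q ω) ∂μ := by
        rw [integral_add i5 i3, integral_add i1 i2, hmean, add_zero, integral_add i1 i4,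
          integral_mul_condExp hmΩ hVL hVLb hX' hXb hXq]
    _ ≤ ∫ ω, W ω ∂μ := by
        refine integral_mono (i1.add i4) (hWb.integrable hW') fun ω => ?_
        have h2 := mul_le_mul_of_nonneg_left (Real.add_one_le_exp (L ω ^ 2 * q ω)) (hV0 ω)
        have h3 : V ω * Real.exp (L ω ^ 2 * q ω) = W ω := by
          rw [hV, mul_assoc, ← Real.exp_add, neg_add_cancel, Real.exp_zero, mul_one]
        simp only
        linarith

end Supermartingale

/-! ### Epochs, histories and action indicators -/

theorem epochOf_eq {s t : ℕ} (hs : 1 ≤ s) (ht : t ∈ epochRounds s) : epochOf t = s := by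
  obtain ⟨h1, h2⟩ := Finset.mem_Ico.1 ht
  obtain ⟨k, rfl⟩ : ∃ k, s = k + 1 := ⟨s - 1, by omega⟩
  rw [epochOf, Nat.log_eq_of_pow_le_of_lt_pow h1 h2, Nat.add_sub_cancel]

theorem one_le_of_mem_epochRounds {s t : ℕ} (ht : t ∈ epochRounds s) : 1 ≤ t :=
  Nat.one_le_two_pow.trans (Finset.mem_Ico.1 ht).1

theorem card_epochRounds {s : ℕ} (hs : 1 ≤ s) : (epochRounds s).card = 2 ^ (s - 1) := by
  obtain ⟨k, rfl⟩ : ∃ k, s = k + 1 := ⟨s - 1, by omega⟩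
  simp [epochRounds, pow_succ]
  omega

theorem start_mem_epochRounds {s : ℕ} (hs : 1 ≤ s) : 2 ^ (s - 1) ∈ epochRounds s :=
  Finset.mem_Ico.2 ⟨le_rfl, Nat.pow_lt_pow_right (by norm_num) (by omega)⟩

section Observations

variable {Ω : Type*} {d : ℕ}

/-- The indicator of the event that the action pair `(a, b)` is played in round `t`. -/
noncomputable def pairIndicator (i j : ℕ → Ω → Fin d) (a b : Fin d) (t : ℕ) : Ω → ℝ :=
  {ω | i t ω = a ∧ j t ω = b}.indicator (fun _ => (1 : ℝ))

theorem pairIndicator_eq_zero_or_one (i j : ℕ → Ω → Fin d) (a b : Fin d) (t : ℕ) (ω : Ω) :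
    pairIndicator i j a b t ω = 0 ∨ pairIndicator i j a b t ω = 1 := by
  by_cases h : ω ∈ {ω | i t ω = a ∧ j t ω = b}
  · exact Or.inr (Set.indicator_of_mem h _)
  · exact Or.inl (Set.indicator_of_notMem h _)

theorem pairIndicator_apply (i j : ℕ → Ω → Fin d) (a b : Fin d) (t : ℕ) (ω : Ω) :
    pairIndicator i j a b t ω = if i t ω = a ∧ j t ω = b then 1 else 0 := by
  simp [pairIndicator, Set.indicator_apply]

theorem measurable_pairIndicator {m : MeasurableSpace Ω} {i j : ℕ → Ω → Fin d} {t : ℕ}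
    (hi : Measurable (i t)) (hj : Measurable (j t)) (a b : Fin d) :
    Measurable (pairIndicator i j a b t) :=
  measurable_const.indicator
    ((hi (measurableSet_singleton a)).inter (hj (measurableSet_singleton b)))

theorem history_mono (i j : ℕ → Ω → Fin d) (r : ℕ → Ω → ℝ) {t k : ℕ} (h : t ≤ k) :
    history i j r t ≤ history i j r k :=
  biSup_mono fun _ hτ => Finset.Ico_subset_Ico_right h hτ

theorem measurable_history (i j : ℕ → Ω → Fin d) (r : ℕ → Ω → ℝ) {t k : ℕ} (ht : 1 ≤ t)
    (h : t < k) : Measurable[history i j r k] (i t) ∧ Measurable[history i j r k] (j t) ∧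
      Measurable[history i j r k] (r t) := by
  have hle : (MeasurableSpace.comap (i t) inferInstance ⊔
      MeasurableSpace.comap (j t) inferInstance ⊔ MeasurableSpace.comap (r t) inferInstance) ≤
      history i j r k :=
    le_iSup₂ (f := fun τ (_ : τ ∈ Finset.Ico 1 k) => (MeasurableSpace.comap (i τ) inferInstance ⊔
      MeasurableSpace.comap (j τ) inferInstance ⊔ MeasurableSpace.comap (r τ) inferInstance))
      t (Finset.mem_Ico.2 ⟨ht, h⟩)
  exact ⟨measurable_iff_comap_le.2 ((le_sup_left.trans le_sup_left).trans hle),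
    measurable_iff_comap_le.2 ((le_sup_right.trans le_sup_left).trans hle),
    measurable_iff_comap_le.2 (le_sup_right.trans hle)⟩

end Observations

/-! ### Concentration within one epoch -/

namespace IsRun

variable {Ω : Type*} [mΩ : MeasurableSpace Ω] {μ : Measure Ω} {d : ℕ}
  {A : Matrix (Fin d) (Fin d) ℝ} {g : ℕ → ℝ} {i j : ℕ → Ω → Fin d} {r : ℕ → Ω → ℝ}

theorem history_le (h : IsRun μ A g i j r) (t : ℕ) : history i j r t ≤ mΩ := by
  refine iSup₂_le fun τ hτ => ?_
  have h1 := (Finset.mem_Ico.1 hτ).1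
  exact sup_le (sup_le (h.measurable_row τ h1).comap_le (h.measurable_col τ h1).comap_le)
    (h.measurable_feedback τ h1).comap_le

/-- In all rounds of an epoch, the actions have the conditional law of its first round. -/
theorem condExp_pairIndicator (h : IsRun μ A g i j r) {s t : ℕ} (hs : 1 ≤ s)
    (ht : t ∈ epochRounds s) (a b : Fin d) :
    μ[pairIndicator i j a b t | history i j r t] =ᵐ[μ]
      μ[pairIndicator i j a b (2 ^ (s - 1)) | history i j r (2 ^ (s - 1))] := by
  have h1 := h.sampling t (one_le_of_mem_epochRounds ht) a b
  have h2 := h.sampling _ (one_le_of_mem_epochRounds (start_mem_epochRounds hs)) a b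
  simp only [rowPlay, colPlay, epochOf_eq hs ht] at h1
  simp only [rowPlay, colPlay, epochOf_eq hs (start_mem_epochRounds hs)] at h2
  exact h1.trans h2.symm

/-- The counts and the feedback of one action pair concentrate in each epoch, relative to the
probability of the pair. -/
theorem concentration [IsProbabilityMeasure μ] (h : IsRun μ A g i j r) (hA : ∀ a b, |A a b| ≤ 1) {s : ℕ} (hs : 1 ≤ s)
    {l : ℝ} (hl : 0 < l) (a b : Fin d) {q : Ω → ℝ}
    (hq : q = μ[pairIndicator i j a b (2 ^ (s - 1)) | history i j r (2 ^ (s - 1))]) :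
    ∃ B : Set Ω, MeasurableSet B ∧ μ B ≤ ENNReal.ofReal (3 * Real.exp (-l)) ∧
      ∀ ω ∉ B, 8 * l ≤ 2 ^ (s - 1) * q ω →
        2 ^ (s - 1) * q ω / 2 ≤ ∑ t ∈ epochRounds s, pairIndicator i j a b t ω ∧
        |∑ t ∈ epochRounds s, pairIndicator i j a b t ω * (r t ω - A a b)| ≤
          2 * √(l * (2 ^ (s - 1) * q ω)) := by
  set T := 2 ^ (s - 1) with hT
  have hT1 : 1 ≤ T := Nat.one_le_two_pow
  have hTs : T ≤ 2 ^ s := Nat.pow_le_pow_right (by norm_num) (by omega)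
  set X := pairIndicator i j a b with hX
  have hmem : ∀ {t}, T ≤ t → t < 2 ^ s → t ∈ epochRounds s := fun h1 h2 =>
    Finset.mem_Ico.2 ⟨h1, h2⟩
  have hX01 : ∀ t ω, X t ω = 0 ∨ X t ω = 1 := pairIndicator_eq_zero_or_one i j a b
  have hXk : ∀ t k, 1 ≤ t → t < k → Measurable[history i j r k] (X t) := fun t k h1 h2 =>
    measurable_pairIndicator (measurable_history i j r h1 h2).1 (measurable_history i j r h1 h2).2.1
      a b
  have hXm : ∀ t, 1 ≤ t → Measurable (X t) := fun t h1 =>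
    measurable_pairIndicator (h.measurable_row t h1) (h.measurable_col t h1) a b
  have hXle : ∀ t ω, |X t ω| ≤ 1 := fun t ω => by rcases hX01 t ω with h | h <;> simp [h]
  have hXb : ∀ t, AEBounded μ (X t) := fun t => ⟨1, Filter.Eventually.of_forall (hXle t)⟩
  -- Taking `q` to be a conditional expectation at the start of the epoch makes it measurable
  -- without proving that the strategies depend measurably on the observations.
  have hqT : Measurable[history i j r T] q := hq ▸ stronglyMeasurable_condExp.measurable
  have hqk : ∀ k, T ≤ k → Measurable[history i j r k] q := fun k hk =>
    hqT.mono (history_mono i j r hk) le_rfl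
  have hqb : AEBounded μ q := by
    refine ⟨1, ?_⟩
    rw [hq]
    exact ae_bdd_abs_condExp_of_ae_bdd_abs (Filter.Eventually.of_forall (hXle T))
  have hXq : ∀ t, T ≤ t → t < 2 ^ s → μ[X t | history i j r t] =ᵐ[μ] q := fun t h1 h2 =>
    hq ▸ h.condExp_pairIndicator hs (hmem h1 h2) a b
  have hrb : ∀ t, 1 ≤ t → ∀ᵐ ω ∂μ, |r t ω| ≤ 1 := fun t ht => by
    filter_upwards [h.feedback_mem t ht] with ω hω using abs_le.2 hω
  have hrb' : ∀ t, 1 ≤ t → AEBounded μ (r t) := fun t ht => ⟨1, hrb t ht⟩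
  -- the count
  obtain ⟨m0, b0⟩ := measure_le_sum_le (μ := μ) (ℱ := history i j r) (a := T) (b := 2 ^ s)
    (fun t _ => h.history_le t) (D := fun t ω => 5 / 8 * q ω - X t ω)
    (fun t k h1 h2 => ((hqk k (h1.trans h2.le)).const_mul _).sub (hXk t k (hT1.trans h1) h2))
    (fun t _ _ => ((AEBounded.const _).mul hqb).sub (hXb t))
    (fun t h1 h2 W hW hW0 hWb => integral_mul_exp_count_le (h.history_le t) (hXm t (hT1.trans h1))
      (hX01 t) (hqk t h1) hqb (hXq t h1 h2) hW hW0 hWb) hTs l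
  -- the deviations
  have hdev : ∀ L : Ω → ℝ, Measurable[history i j r T] L → (∀ ω, |L ω| ≤ 1 / 2) →
      MeasurableSet {ω | l ≤ ∑ t ∈ Finset.Ico T (2 ^ s),
        (L ω * (X t ω * (r t ω - A a b)) - L ω ^ 2 * q ω)} ∧
      μ {ω | l ≤ ∑ t ∈ Finset.Ico T (2 ^ s),
        (L ω * (X t ω * (r t ω - A a b)) - L ω ^ 2 * q ω)} ≤ ENNReal.ofReal (Real.exp (-l)) := by
    intro L hL hLb
    have hLk : ∀ k, T ≤ k → Measurable[history i j r k] L := fun k hk =>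
      hL.mono (history_mono i j r hk) le_rfl
    have hLb' : AEBounded μ L := ⟨1 / 2, Filter.Eventually.of_forall hLb⟩
    have hL2b : AEBounded μ fun ω => L ω ^ 2 := by simpa only [pow_two] using hLb'.mul hLb'
    refine measure_le_sum_le (μ := μ) (ℱ := history i j r) (a := T) (b := 2 ^ s)
      (fun t _ => h.history_le t)
      (D := fun t ω => L ω * (X t ω * (r t ω - A a b)) - L ω ^ 2 * q ω) ?_ ?_ ?_ hTs l
    · intro t k h1 h2
      have hr := (measurable_history i j r (hT1.trans h1) h2).2.2
      have hk := h1.trans h2.le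
      exact ((hLk k hk).mul ((hXk t k (hT1.trans h1) h2).mul (hr.sub measurable_const))).sub
        (((hLk k hk).pow_const 2).mul (hqk k hk))
    · intro t h1 h2
      exact (hLb'.mul ((hXb t).mul ((hrb' t (hT1.trans h1)).sub (AEBounded.const _)))).sub
        (hL2b.mul hqb)
    · intro t h1 h2 W hW hW0 hWb
      have ht := hT1.trans h1
      have hi : Measurable[history i j r t ⊔ (MeasurableSpace.comap (i t) inferInstance ⊔
          MeasurableSpace.comap (j t) inferInstance)] (i t) :=
        measurable_iff_comap_le.2 (le_sup_left.trans le_sup_right)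
      have hj : Measurable[history i j r t ⊔ (MeasurableSpace.comap (i t) inferInstance ⊔
          MeasurableSpace.comap (j t) inferInstance)] (j t) :=
        measurable_iff_comap_le.2 (le_sup_right.trans le_sup_right)
      refine integral_mul_exp_deviation_le (m := history i j r t) le_sup_left
        (sup_le (h.history_le t) (sup_le (h.measurable_row t ht).comap_le
          (h.measurable_col t ht).comap_le)) (hA a b) (measurable_pairIndicator hi hj a b)
        (hX01 t) (hqk t h1) hqb (hXq t h1 h2) (h.measurable_feedback t ht) (hrb t ht)
        (h.feedback_mean t ht) (fun ω => ?_) (hLk t h1) hLb hW hW0 hWb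
      by_cases hab : i t ω = a ∧ j t ω = b
      · simp only [hab.1, hab.2]
      · have : X t ω = 0 := by rw [hX, pairIndicator_apply, if_neg hab]
        rw [this, zero_mul, zero_mul]
  -- The optimal exponent for total variance `T * q`, known at the start of the epoch and thus
  -- allowed to be random. The cap keeps the exponents bounded and is inactive once `T * q ≥ 4 * l`.
  set L : Ω → ℝ := fun ω => min (1 / 2) √(l / (T * q ω)) with hLdef
  have hL : Measurable[history i j r T] L :=
    measurable_const.min (measurable_const.div (hqT.const_mul _)).sqrt
  have hL0 : ∀ ω, 0 ≤ L ω := fun ω => le_min (by norm_num) (Real.sqrt_nonneg _)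
  have hLb : ∀ ω, |L ω| ≤ 1 / 2 := fun ω => by
    rw [abs_of_nonneg (hL0 ω)]
    exact min_le_left _ _
  obtain ⟨m1, b1⟩ := hdev L hL hLb
  obtain ⟨m2, b2⟩ := hdev (fun ω => -L ω) hL.neg fun ω => by rw [abs_neg]; exact hLb ω
  refine ⟨_, (m0.union m1).union m2, ?_, ?_⟩
  · calc _ ≤ ENNReal.ofReal (Real.exp (-l)) + ENNReal.ofReal (Real.exp (-l)) +
          ENNReal.ofReal (Real.exp (-l)) :=
        (measure_union_le _ _).trans (add_le_add ((measure_union_le _ _).trans (add_le_add b0 b1)) b2)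
      _ = _ := by
        rw [← ENNReal.ofReal_add (Real.exp_pos _).le (Real.exp_pos _).le,
          ← ENNReal.ofReal_add (by positivity) (Real.exp_pos _).le]
        congr 1
        ring
  · intro ω hω hbig
    simp only [Set.mem_union, Set.mem_ofPred_eq, not_or, not_le, Finset.sum_sub_distrib,
      ← Finset.mul_sum, Finset.sum_const, Nat.card_Ico, nsmul_eq_mul] at hω
    have hcard : ((2 ^ s - T : ℕ) : ℝ) = T := by
      have := card_epochRounds hs
      rw [epochRounds, Nat.card_Ico] at this
      rw [← hT] at this
      exact_mod_cast this
    rw [hcard] at hω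
    obtain ⟨⟨w0, w1⟩, w2⟩ := hω
    have hTcast : (2 : ℝ) ^ (s - 1) = (T : ℝ) := by rw [hT]; push_cast; rfl
    rw [hTcast] at hbig ⊢
    have hepoch : epochRounds s = Finset.Ico T (2 ^ s) := rfl
    rw [hepoch]
    set Q : ℝ := T * q ω with hQ
    set S := ∑ t ∈ Finset.Ico T (2 ^ s), X t ω * (r t ω - A a b) with hS
    have hQ0 : 0 < Q := by linarith
    -- The count exceeds `5 / 8 * Q - l`, which is at least `Q / 2` because `l ≤ Q / 8`.
    refine ⟨by nlinarith, ?_⟩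
    have hLeq : L ω = √(l / Q) := by
      refine min_eq_right ?_
      rw [show (1 / 2 : ℝ) = √(1 / 4) by
        rw [show (1 / 4 : ℝ) = (1 / 2) ^ 2 by norm_num, Real.sqrt_sq (by norm_num)]]
      refine Real.sqrt_le_sqrt ?_
      rw [div_le_div_iff₀ hQ0 (by norm_num)]
      linarith
    have hLpos : 0 < L ω := hLeq ▸ Real.sqrt_pos.2 (div_pos hl hQ0)
    have e1 : L ω ^ 2 * Q = l := by
      rw [hLeq, Real.sq_sqrt (div_pos hl hQ0).le, div_mul_cancel₀ _ hQ0.ne']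
    have e2 : L ω * √(l * Q) = l := by
      rw [hLeq, ← Real.sqrt_mul (div_pos hl hQ0).le,
        show l / Q * (l * Q) = l ^ 2 by field_simp, Real.sqrt_sq hl.le]
    rw [e1] at w1
    rw [neg_sq, e1] at w2
    -- Both signs give `L * |S| < 2 * l`, and `2 * l = L * (2 * √(l * Q))`.
    refine abs_le.2 ⟨?_, ?_⟩ <;> refine le_of_mul_le_mul_left ?_ hLpos <;> linarith

end IsRun

/-! ### Learning rates and the accuracy they need -/

/-- The logarithmic confidence term of epoch `s`. -/
noncomputable def confidence (d : ℕ) (δ : ℝ) (s : ℕ) : ℝ :=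
  Real.log (8 * (d : ℝ) ^ 2 * (s : ℝ) ^ 2 / δ)

section Rates

variable {d : ℕ} [NeZero d] {δ : ℝ}

theorem one_lt_confidence_arg (hδ : 0 < δ) (hδ1 : δ < 1) {s : ℕ} (hs : 1 ≤ s) :
    8 < 8 * (d : ℝ) ^ 2 * (s : ℝ) ^ 2 / δ := by
  have hd : (1 : ℝ) ≤ d := Nat.one_le_cast.2 (NeZero.pos d)
  have hs' : (1 : ℝ) ≤ s := Nat.one_le_cast.2 hs
  rw [lt_div_iff₀ hδ]
  have h1 : (1 : ℝ) ≤ (d : ℝ) ^ 2 := one_le_pow₀ hd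
  have h2 : (1 : ℝ) ≤ (s : ℝ) ^ 2 := one_le_pow₀ hs'
  nlinarith

theorem one_lt_confidence (hδ : 0 < δ) (hδ1 : δ < 1) {s : ℕ} (hs : 1 ≤ s) :
    1 < confidence d δ s := by
  have h := one_lt_confidence_arg (d := d) hδ hδ1 hs
  rw [confidence, Real.lt_log_iff_exp_lt (by linarith)]
  linarith [Real.exp_one_lt_d9]

theorem exp_neg_confidence (hδ : 0 < δ) (hδ1 : δ < 1) {s : ℕ} (hs : 1 ≤ s) :
    Real.exp (-confidence d δ s) = δ / (8 * (d : ℝ) ^ 2 * (s : ℝ) ^ 2) := by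
  have h := one_lt_confidence_arg (d := d) hδ hδ1 hs
  rw [confidence, Real.exp_neg, Real.exp_log (by linarith), inv_div]

theorem confidence_le_succ (hδ : 0 < δ) (hδ1 : δ < 1) {s : ℕ} (hs : 1 ≤ s) :
    confidence d δ s ≤ confidence d δ (s + 1) := by
  have h := one_lt_confidence_arg (d := d) hδ hδ1 hs
  refine Real.log_le_log (by linarith) ?_
  push_cast
  gcongr
  linarith

/-- The argument of the logarithm grows by at most a factor 4, which is less than squaring it as it
exceeds 8. Doubling is what the factor `2 ^ s` compensates, so the learning rates decrease. -/
theorem confidence_succ_le (hδ : 0 < δ) (hδ1 : δ < 1) {s : ℕ} (hs : 1 ≤ s) :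
    confidence d δ (s + 1) ≤ 2 * confidence d δ s := by
  have h := one_lt_confidence_arg (d := d) hδ hδ1 hs
  have h' := one_lt_confidence_arg (d := d) hδ hδ1 (s := s + 1) (by omega)
  have hs' : (1 : ℝ) ≤ s := Nat.one_le_cast.2 hs
  have e : 2 * confidence d δ s = Real.log ((8 * (d : ℝ) ^ 2 * (s : ℝ) ^ 2 / δ) ^ 2) := by
    rw [Real.log_pow, confidence]
    norm_num
  rw [e]
  refine Real.log_le_log (by linarith) ?_
  have h1 : 8 * (d : ℝ) ^ 2 * ((s + 1 : ℕ) : ℝ) ^ 2 / δ ≤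
      4 * (8 * (d : ℝ) ^ 2 * (s : ℝ) ^ 2 / δ) := by
    rw [← mul_div_assoc]
    refine div_le_div_of_nonneg_right ?_ hδ.le
    push_cast
    have : ((s : ℝ) + 1) ^ 2 ≤ 4 * (s : ℝ) ^ 2 := by nlinarith
    nlinarith [mul_le_mul_of_nonneg_left this (by positivity : (0 : ℝ) ≤ 8 * (d : ℝ) ^ 2)]
  nlinarith

theorem learningRate_eq (d : ℕ) (δ : ℝ) (s : ℕ) :
    learningRate d δ s = 128 * d * √(confidence d δ s / 2 ^ s) := by
  have : (2 : ℝ) ^ (-(s : ℝ) / 2) = (√(2 ^ s))⁻¹ := by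
    rw [neg_div, Real.rpow_neg (by norm_num), Real.sqrt_eq_rpow, ← Real.rpow_natCast,
      ← Real.rpow_mul (by norm_num)]
    congr 2
    ring
  rw [learningRate, this, ← confidence, Real.sqrt_div' _ (by positivity)]
  ring

theorem learningRate_sq (hδ : 0 < δ) (hδ1 : δ < 1) {s : ℕ} (hs : 1 ≤ s) :
    learningRate d δ s ^ 2 = 128 ^ 2 * d ^ 2 * (confidence d δ s / 2 ^ s) := by
  have := one_lt_confidence (d := d) hδ hδ1 hs
  rw [learningRate_eq, mul_pow, mul_pow, Real.sq_sqrt (by positivity)]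

theorem learningRate_pos (hδ : 0 < δ) (hδ1 : δ < 1) {s : ℕ} (hs : 1 ≤ s) :
    0 < learningRate d δ s := by
  have hd : (0 : ℝ) < d := Nat.cast_pos.2 (NeZero.pos d)
  have := one_lt_confidence (d := d) hδ hδ1 hs
  rw [learningRate_eq]
  positivity

theorem eight_le_learningRate_one (hδ : 0 < δ) (hδ1 : δ < 1) : 8 ≤ learningRate d δ 1 := by
  have hd : (1 : ℝ) ≤ d := Nat.one_le_cast.2 (NeZero.pos d)
  have h1 := one_lt_confidence (d := d) hδ hδ1 le_rfl
  have h2 := learningRate_sq (d := d) hδ hδ1 le_rfl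
  refine le_of_sq_le_sq (a := 8) ?_ (learningRate_pos hδ hδ1 le_rfl).le
  rw [h2]
  have h3 : (1 : ℝ) ≤ (d : ℝ) ^ 2 := one_le_pow₀ hd
  nlinarith

theorem learningRate_succ_le (hδ : 0 < δ) (hδ1 : δ < 1) {s : ℕ} (hs : 1 ≤ s) :
    learningRate d δ (s + 1) ≤ learningRate d δ s := by
  rw [learningRate_eq, learningRate_eq]
  gcongr 128 * _ * √?_
  rw [pow_succ, div_le_div_iff₀ (by positivity) (by positivity)]
  have h1 := confidence_succ_le (d := d) hδ hδ1 hs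
  nlinarith [mul_le_mul_of_nonneg_right h1 (by positivity : (0 : ℝ) ≤ 2 ^ s)]

/-- The confidence does not decrease, so the squared rate at most halves from one epoch to the next.
-/
theorem confidence_le_learningRate_succ_sq (hδ : 0 < δ) (hδ1 : δ < 1) {s : ℕ} (hs : 1 ≤ s) :
    128 ^ 2 * d ^ 2 * (confidence d δ s / 2 ^ s) ≤ 2 * learningRate d δ (s + 1) ^ 2 := by
  have h1 := confidence_le_succ (d := d) hδ hδ1 hs
  rw [learningRate_sq hδ hδ1 (by omega : 1 ≤ s + 1), pow_succ (2 : ℝ) s, ← div_div]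
  have h2 : confidence d δ s / 2 ^ s ≤ confidence d δ (s + 1) / 2 ^ s := by gcongr
  nlinarith [mul_le_mul_of_nonneg_left h2 (by positivity : (0 : ℝ) ≤ 128 ^ 2 * (d : ℝ) ^ 2)]

/-- The accuracy of an empirical mean, from the bounds on the count and on the deviation. -/
theorem abs_deviation_le (hδ : 0 < δ) (hδ1 : δ < 1) {s : ℕ} (hs : 1 ≤ s)
    (h8 : learningRate d δ (s + 1) < 8) {p q N S : ℝ}
    (hp : learningRate d δ s / (2 + learningRate d δ s * d) ≤ p)
    (hq : learningRate d δ s / (2 + learningRate d δ s * d) ≤ q)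
    (hconc : 8 * confidence d δ s ≤ 2 ^ (s - 1) * (p * q) →
      2 ^ (s - 1) * (p * q) / 2 ≤ N ∧ |S| ≤ 2 * √(confidence d δ s * (2 ^ (s - 1) * (p * q)))) :
    0 < N ∧ |S / N| ≤ learningRate d δ (s + 1) / (16 * d) / (√p * √q) := by
  have hd : (1 : ℝ) ≤ d := Nat.one_le_cast.2 (NeZero.pos d)
  have hd0 : (0 : ℝ) < d := by linarith
  have hl := one_lt_confidence (d := d) hδ hδ1 hs
  have hg0 := learningRate_pos (d := d) hδ hδ1 hs
  have hg1 := learningRate_pos (d := d) hδ hδ1 (by omega : 1 ≤ s + 1)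
  have hsq := learningRate_sq (d := d) hδ hδ1 hs
  have hsucc := confidence_le_learningRate_succ_sq (d := d) hδ hδ1 hs
  have hpow : (2 : ℝ) ^ s = 2 * 2 ^ (s - 1) := by
    rw [← pow_succ']
    congr 1
    omega
  set g := learningRate d δ s
  set g' := learningRate d δ (s + 1)
  set l := confidence d δ s
  set n : ℝ := 2 ^ (s - 1)
  have hn : 0 < n := by positivity
  rw [hpow] at hsq hsucc
  -- The next rate is below 8 and the squares differ by a factor of at most 2, so `g ^ 2 ≤ 128 ≤
  -- 144`. Hence `2 + g * d ≤ 14 * d` in the exploration bound.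
  have hg12 : g ≤ 12 := by
    refine le_of_sq_le_sq (b := (12 : ℝ)) ?_ (by norm_num)
    nlinarith
  have hlow : g / (14 * d) ≤ g / (2 + g * d) :=
    div_le_div_of_nonneg_left hg0.le (by positivity) (by nlinarith)
  have hp' := hlow.trans hp
  have hq' := hlow.trans hq
  have hz : 0 < g / (14 * d) := by positivity
  have hp0 := hz.trans_le hp'
  have hq0 := hz.trans_le hq'
  have hpq : (g / (14 * d)) ^ 2 ≤ p * q := by
    rw [pow_two]
    exact mul_le_mul hp' hq' hz.le hp0.le
  -- The minimal exploration gives an expected count of at least `n * (g / (14 * d)) ^ 2 = 128 ^ 2 /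
  -- 392 * l`, about `41 * l`.
  have hQ : 8 * l ≤ n * (p * q) := by
    refine le_trans ?_ (mul_le_mul_of_nonneg_left hpq hn.le)
    rw [div_pow, hsq]
    have : n * (128 ^ 2 * (d : ℝ) ^ 2 * (l / (2 * n)) / (14 * d) ^ 2) = 128 ^ 2 / 392 * l := by
      field_simp
      norm_num
    rw [this]
    linarith
  obtain ⟨hN, hS⟩ := hconc hQ
  set P := p * q with hP
  have hP0 : 0 < P := mul_pos hp0 hq0
  have hN0 : 0 < N := by linarith
  refine ⟨hN0, ?_⟩
  rw [abs_div, abs_of_pos hN0, div_le_iff₀ hN0, ← Real.sqrt_mul hp0.le, ← hP]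
  -- The constant 128 in the learning rate is exactly what this step needs: it yields `g' ≥ 64 * d *
  -- √(l / n)`.
  have hkey : 4 * √(l / n) ≤ g' / (16 * d) := by
    rw [show (4 : ℝ) = √(16) by
      rw [show (16 : ℝ) = 4 ^ 2 by norm_num, Real.sqrt_sq (by norm_num)],
      ← Real.sqrt_mul (by norm_num)]
    refine Real.sqrt_le_iff.2 ⟨by positivity, ?_⟩
    rw [div_pow, le_div_iff₀ (by positivity)]
    have e : 128 ^ 2 * (d : ℝ) ^ 2 * (l / (2 * n)) = 2 * (16 * (l / n) * (16 * d) ^ 2) := by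
      field_simp
      norm_num
    linarith
  have hsplit : √(l * (n * P)) = √(l / n) / √P * (n * P) := by
    rw [show l * (n * P) = l / n / P * (n * P) ^ 2 by field_simp,
      Real.sqrt_mul (by positivity), Real.sqrt_sq (by positivity), Real.sqrt_div (by positivity)]
  calc |S| ≤ 4 * √(l / n) / √P * (n * P / 2) := by
        refine hS.trans (le_of_eq ?_)
        rw [hsplit]
        ring
    _ ≤ g' / (16 * d) / √P * N := by gcongr

end Rates

/-- The final comparison between the learning rate and the rate of the theorem. -/
theorem learningRate_epochOf_le {d : ℕ} [NeZero d] {δ : ℝ} (hδ : 0 < δ) (hδ1 : δ < 1) {t : ℕ}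
    (ht : 1 ≤ t) : 3 * learningRate d δ (epochOf t) * d ≤
      3840 * (d : ℝ) ^ 2 * √(Real.log (d * Real.log (max (t : ℝ) 3) / δ) / t) := by
  have hd : (1 : ℝ) ≤ d := Nat.one_le_cast.2 (NeZero.pos d)
  have ht' : (1 : ℝ) ≤ t := Nat.one_le_cast.2 ht
  have hs : 1 ≤ epochOf t := by simp [epochOf]
  set s := epochOf t with hsdef
  set L := Real.log (max (t : ℝ) 3) with hL
  have hlog3 : (1.09 : ℝ) ≤ Real.log 3 := by
    have h1 : Real.log 3 = 1 + Real.log (3 / Real.exp 1) := by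
      rw [Real.log_div (by norm_num) (Real.exp_pos 1).ne', Real.log_exp]
      ring
    have h2 := Real.one_sub_inv_le_log_of_pos (div_pos (by norm_num : (0 : ℝ) < 3) (Real.exp_pos 1))
    rw [inv_div] at h2
    linarith [Real.exp_one_lt_d9]
  have hL1 : (1.09 : ℝ) ≤ L := hlog3.trans (Real.log_le_log (by norm_num) (le_max_right _ _))
  have hsL : (s : ℝ) ≤ 3 * L := by
    have h1 : (2 : ℝ) ^ Nat.log 2 t ≤ max (t : ℝ) 3 :=
      le_trans (by exact_mod_cast Nat.pow_log_le_self 2 (by omega)) (le_max_left _ _)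
    have h2 := Real.log_le_log (by positivity) h1
    rw [Real.log_pow] at h2
    have h3 : (s : ℝ) = Nat.log 2 t + 1 := by rw [hsdef, epochOf]; push_cast; rfl
    have h4 : (0 : ℝ) ≤ Nat.log 2 t := Nat.cast_nonneg _
    nlinarith [Real.log_two_gt_d9]
  have hx : L ≤ d * L / δ := by
    rw [le_div_iff₀ hδ]
    nlinarith
  set x := d * L / δ with hxdef
  -- The maximum with 3 keeps `x` above 1.09; this positive lower bound lets the additive constant
  -- `7 * log 2` be absorbed into a multiple of `log x`.
  have hlogx : (0.08 : ℝ) ≤ Real.log x := by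
    have h2 := Real.one_sub_inv_le_log_of_pos (by linarith : 0 < x)
    have h3 : x⁻¹ ≤ (1.09 : ℝ)⁻¹ := inv_anti₀ (by norm_num) (by linarith)
    norm_num at h3 h2 ⊢
    linarith
  have hconf : confidence d δ s ≤ 100 * Real.log x := by
    have h0 := one_lt_confidence_arg (d := d) hδ hδ1 hs
    have h1 : 8 * (d : ℝ) ^ 2 * (s : ℝ) ^ 2 / δ ≤ 2 ^ 7 * x ^ 2 := by
      rw [hxdef, div_pow, ← mul_div_assoc, div_le_div_iff₀ hδ (by positivity)]
      have h2 : (s : ℝ) ^ 2 ≤ (3 * L) ^ 2 := pow_le_pow_left₀ (Nat.cast_nonneg s) hsL 2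
      have h3 : δ ^ 2 ≤ δ := by nlinarith
      calc 8 * (d : ℝ) ^ 2 * (s : ℝ) ^ 2 * δ ^ 2 ≤ 8 * (d : ℝ) ^ 2 * (3 * L) ^ 2 * δ := by gcongr
        _ ≤ 2 ^ 7 * (d * L) ^ 2 * δ := by
          nlinarith [mul_nonneg (sq_nonneg ((d : ℝ) * L)) hδ.le]
    have h2 := Real.log_le_log (by linarith) h1
    rw [Real.log_mul (by norm_num) (by positivity), Real.log_pow, Real.log_pow] at h2
    rw [confidence]
    push_cast at h2
    linarith [Real.log_two_lt_d9]
  have hts : (t : ℝ) ≤ 2 ^ s := by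
    have := (Finset.mem_Ico.1 (mem_epochRounds_epochOf ht)).2.le
    exact_mod_cast this
  have hroot : √(confidence d δ s / 2 ^ s) ≤ 10 * √(Real.log x / t) := by
    rw [show (10 : ℝ) = √(100) by
      rw [show (100 : ℝ) = 10 ^ 2 by norm_num, Real.sqrt_sq (by norm_num)],
      ← Real.sqrt_mul (by norm_num), ← mul_div_assoc]
    exact Real.sqrt_le_sqrt (div_le_div₀ (by linarith) hconf (by linarith) hts)
  rw [learningRate_eq]
  nlinarith [mul_le_mul_of_nonneg_left hroot (sq_nonneg (d : ℝ))]

/-! ### The estimator and the union bound -/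

theorem abs_gameEstimate_le {d : ℕ} {i j : ℕ → Fin d} {r : ℕ → ℝ} (hr : ∀ t, 1 ≤ t → |r t| ≤ 1)
    (s : ℕ) (a b : Fin d) : |gameEstimate i j r s a b| ≤ 1 := by
  match s with
  | 0 => simp [gameEstimate]
  | 1 => simp [gameEstimate]
  | s + 2 =>
    simp only [gameEstimate]
    split_ifs with h
    · simp
    · have hN : (0 : ℝ) < pairCount i j (s + 1) a b := Nat.cast_pos.2 (Nat.pos_of_ne_zero h)
      rw [abs_div, abs_of_pos hN, div_le_one hN]
      refine (Finset.abs_sum_le_sum_abs _ _).trans ?_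
      rw [pairCount, Finset.card_filter]
      push_cast
      refine Finset.sum_le_sum fun t ht => ?_
      split_ifs
      · exact hr t (one_le_of_mem_epochRounds ht)
      · simp

theorem gameEstimate_succ_sub {Ω : Type*} {d : ℕ} {i j : ℕ → Ω → Fin d} {r : ℕ → Ω → ℝ} {ω : Ω}
    {A : Matrix (Fin d) (Fin d) ℝ} {s : ℕ} (hs : 1 ≤ s) (a b : Fin d)
    (hN : 0 < ∑ t ∈ epochRounds s, pairIndicator i j a b t ω) :
    (gameEstimate (fun τ => i τ ω) (fun τ => j τ ω) (fun τ => r τ ω) (s + 1) - A) a b =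
      (∑ t ∈ epochRounds s, pairIndicator i j a b t ω * (r t ω - A a b)) /
        ∑ t ∈ epochRounds s, pairIndicator i j a b t ω := by
  obtain ⟨k, rfl⟩ : ∃ k, s = k + 1 := ⟨s - 1, by omega⟩
  have hcount : (pairCount (fun τ => i τ ω) (fun τ => j τ ω) (k + 1) a b : ℝ) =
      ∑ t ∈ epochRounds (k + 1), pairIndicator i j a b t ω := by
    simp only [pairCount, Finset.card_filter, pairIndicator_apply]
    push_cast
    rfl
  have hne : pairCount (fun τ => i τ ω) (fun τ => j τ ω) (k + 1) a b ≠ 0 := fun h0 => by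
    rw [h0, Nat.cast_zero] at hcount
    exact hN.ne hcount
  have hsum : ∑ t ∈ epochRounds (k + 1), (if i t ω = a ∧ j t ω = b then r t ω else 0) =
      ∑ t ∈ epochRounds (k + 1), pairIndicator i j a b t ω * r t ω :=
    Finset.sum_congr rfl fun t _ => by
      rw [pairIndicator_apply]
      split_ifs <;> simp
  rw [Matrix.sub_apply]
  simp only [gameEstimate]
  rw [if_neg hne, hcount, hsum, eq_div_iff hN.ne', sub_mul, div_mul_cancel₀ _ hN.ne']
  simp only [mul_sub, Finset.sum_sub_distrib, ← Finset.sum_mul]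
  ring

/-- Epoch `k + 1` fails with probability at most `3 * δ / 8 / (k + 1) ^ 2`: three deviation events
for each of `d ^ 2` pairs. The sum of inverse squares is below 2. -/
theorem tsum_confidence_le {δ : ℝ} (hδ : 0 < δ) :
    ∑' k : ℕ, ENNReal.ofReal (3 * δ / 8 * (1 / ((k + 1 : ℕ) : ℝ) ^ 2)) ≤ ENNReal.ofReal δ := by
  have hs := hasSum_zeta_two.summable
  have hs1 := (summable_nat_add_iff 1).2 hs
  have hle : ∑' k : ℕ, (1 : ℝ) / ((k + 1 : ℕ) : ℝ) ^ 2 ≤ 2 := by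
    have h := hs.tsum_eq_zero_add
    rw [hasSum_zeta_two.tsum_eq] at h
    norm_num at h
    have hpi : Real.pi ^ 2 ≤ 12 := by nlinarith [Real.pi_lt_d2, Real.pi_pos]
    push_cast
    simp only [one_div]
    linarith
  rw [← ENNReal.ofReal_tsum_of_nonneg (fun k => by positivity) (hs1.mul_left _), tsum_mul_left]
  refine ENNReal.ofReal_le_ofReal ?_
  nlinarith

/-- With probability at least `1 - δ`, the counts and the feedback of all action pairs concentrate
in all epochs. -/
theorem IsRun.exists_concentration_event {Ω : Type*} [MeasurableSpace Ω] {μ : Measure Ω}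
    [IsProbabilityMeasure μ] {d : ℕ} [NeZero d] {A : Matrix (Fin d) (Fin d) ℝ} {g : ℕ → ℝ}
    {i j : ℕ → Ω → Fin d} {r : ℕ → Ω → ℝ} (h : IsRun μ A g i j r) (hA : ∀ a b, |A a b| ≤ 1)
    {δ : ℝ} (hδ : 0 < δ) (hδ1 : δ < 1) :
    ∃ E : Set Ω, MeasurableSet E ∧ ENNReal.ofReal (1 - δ) ≤ μ E ∧ ∀ ω ∈ E,
      (∀ t, 1 ≤ t → |r t ω| ≤ 1) ∧ ∀ s, 1 ≤ s → ∀ a b, ∀ Q : ℝ,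
        Q = 2 ^ (s - 1) *
          (rowStrategy (g s) (gameEstimate (fun τ => i τ ω) (fun τ => j τ ω) (fun τ => r τ ω) s) a *
          colStrategy (g s) (gameEstimate (fun τ => i τ ω) (fun τ => j τ ω) (fun τ => r τ ω) s) b) →
        8 * confidence d δ s ≤ Q →
        Q / 2 ≤ ∑ t ∈ epochRounds s, pairIndicator i j a b t ω ∧
        |∑ t ∈ epochRounds s, pairIndicator i j a b t ω * (r t ω - A a b)| ≤
          2 * √(confidence d δ s * Q) := by
  have hd : (0 : ℝ) < d := Nat.cast_pos.2 (NeZero.pos d)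
  have hpos : ∀ k : ℕ, 1 ≤ k + 1 := fun k => by omega
  choose B hBm hBμ hB using fun (k : ℕ) (a b : Fin d) => h.concentration hA (hpos k)
    (zero_lt_one.trans (one_lt_confidence (d := d) hδ hδ1 (hpos k))) a b rfl
  set F : Set Ω := ⋃ k, ⋃ a, ⋃ b, B k a b with hF
  have hFm : MeasurableSet F :=
    MeasurableSet.iUnion fun k => MeasurableSet.iUnion fun a => MeasurableSet.iUnion fun b => hBm k a b
  have hFμ : μ F ≤ ENNReal.ofReal δ := by
    refine (measure_iUnion_le _).trans ((ENNReal.tsum_le_tsum fun k => ?_).trans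
      (tsum_confidence_le hδ))
    calc μ (⋃ a, ⋃ b, B k a b) ≤ ∑ a, ∑ b, μ (B k a b) :=
          (measure_iUnion_fintype_le _ _).trans
            (Finset.sum_le_sum fun a _ => measure_iUnion_fintype_le _ _)
      _ ≤ ∑ _a : Fin d, ∑ _b : Fin d, ENNReal.ofReal (3 * Real.exp (-confidence d δ (k + 1))) :=
          Finset.sum_le_sum fun a _ => Finset.sum_le_sum fun b _ => hBμ k a b
      _ = _ := by
          rw [exp_neg_confidence hδ hδ1 (hpos k)]
          simp only [Finset.sum_const, Finset.card_univ, Fintype.card_fin, nsmul_eq_mul]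
          rw [← ENNReal.ofReal_natCast d, ← ENNReal.ofReal_mul hd.le, ← ENNReal.ofReal_mul hd.le]
          congr 1
          have : ((k + 1 : ℕ) : ℝ) ≠ 0 := by positivity
          field_simp
  have hae : ∀ᵐ ω ∂μ, (∀ t, 1 ≤ t → |r t ω| ≤ 1) ∧ ∀ (k : ℕ) (a b : Fin d),
      (μ[pairIndicator i j a b (2 ^ (k + 1 - 1)) | history i j r (2 ^ (k + 1 - 1))]) ω =
        rowPlay g (fun τ => i τ ω) (fun τ => j τ ω) (fun τ => r τ ω) (2 ^ (k + 1 - 1)) a *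
        colPlay g (fun τ => i τ ω) (fun τ => j τ ω) (fun τ => r τ ω) (2 ^ (k + 1 - 1)) b := by
    refine Filter.Eventually.and (ae_all_iff.2 fun t => ?_)
      (ae_all_iff.2 fun k => ae_all_iff.2 fun a => ae_all_iff.2 fun b =>
        h.sampling _ Nat.one_le_two_pow a b)
    by_cases ht : 1 ≤ t
    · filter_upwards [h.feedback_mem t ht] with ω hω _ using abs_le.2 hω
    · exact Filter.Eventually.of_forall fun ω h1 => absurd h1 ht
  -- The set where the sampling or boundedness conditions fail is null but need not be measurable,
  -- so a measurable null superset is removed.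
  obtain ⟨G, hG, hGm, hG0⟩ := exists_measurable_superset_of_null (ae_iff.1 hae)
  refine ⟨(F ∪ G)ᶜ, (hFm.union hGm).compl, ?_, fun ω hω => ?_⟩
  · rw [prob_compl_eq_one_sub (hFm.union hGm), ENNReal.ofReal_sub _ hδ.le, ENNReal.ofReal_one]
    refine tsub_le_tsub_left ((measure_union_le _ _).trans ?_) _
    rw [hG0, add_zero]
    exact hFμ
  · rw [Set.mem_compl_iff, Set.mem_union, not_or] at hω
    have hgood := not_not.1 fun hn => hω.2 (hG hn)
    refine ⟨hgood.1, fun s hs a b Q hQ => ?_⟩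
    obtain ⟨k, rfl⟩ : ∃ k, s = k + 1 := ⟨s - 1, by omega⟩
    have h1 := hB k a b ω fun hk =>
      hω.1 (Set.mem_iUnion.2 ⟨k, Set.mem_iUnion.2 ⟨a, Set.mem_iUnion.2 ⟨b, hk⟩⟩⟩)
    rw [hgood.2 k a b] at h1
    simp only [rowPlay, colPlay, epochOf_eq hs (start_mem_epochRounds hs)] at h1
    rw [← hQ] at h1
    exact h1

end PMOLB

/-! ### The high-probability bound -/

theorem theorem1 :
    ∃ C : ℝ, 0 < C ∧
      ∀ (d : ℕ), 1 ≤ d →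
      ∀ (A : Matrix (Fin d) (Fin d) ℝ), (∀ a b, A a b ∈ Set.Icc (-1 : ℝ) 1) →
      ∀ (δ : ℝ), 0 < δ → δ < 1 →
      ∀ (Ω : Type*) [MeasurableSpace Ω] (μ : Measure Ω) [IsProbabilityMeasure μ]
        (i j : ℕ → Ω → Fin d) (r : ℕ → Ω → ℝ),
        PMOLB.IsRun μ A (PMOLB.learningRate d δ) i j r →
        ∃ E : Set Ω, MeasurableSet E ∧ ENNReal.ofReal (1 - δ) ≤ μ E ∧
          ∀ ω ∈ E, ∀ t : ℕ, 1 ≤ t →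
            PMOLB.dualityGap A
              (PMOLB.rowPlay (PMOLB.learningRate d δ)
                (fun τ => i τ ω) (fun τ => j τ ω) (fun τ => r τ ω) t)
              (PMOLB.colPlay (PMOLB.learningRate d δ)
                (fun τ => i τ ω) (fun τ => j τ ω) (fun τ => r τ ω) t) ≤
            C * (d : ℝ) ^ 2 *
              Real.sqrt (Real.log ((d : ℝ) * Real.log (max (t : ℝ) 3) / δ) / (t : ℝ)) := by
  refine ⟨3840, by norm_num, fun d hd A hA δ hδ hδ1 Ω _ μ _ i j r h => ?_⟩
  have : NeZero d := ⟨by omega⟩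
  have hA' : ∀ a b, |A a b| ≤ 1 := fun a b => abs_le.2 (hA a b)
  obtain ⟨E, hEm, hEμ, hE⟩ := h.exists_concentration_event hA' hδ hδ1
  refine ⟨E, hEm, hEμ, fun ω hω t ht => ?_⟩
  obtain ⟨hr, hconc⟩ := hE ω hω
  refine le_trans ?_ (PMOLB.learningRate_epochOf_le hδ hδ1 ht)
  have hM := PMOLB.abs_gameEstimate_le (i := fun τ => i τ ω) (j := fun τ => j τ ω) hr
  refine PMOLB.dualityGap_strategies_le hA' (fun s hs => PMOLB.learningRate_pos hδ hδ1 hs)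
    (PMOLB.eight_le_learningRate_one hδ hδ1)
    (fun s hs => PMOLB.learningRate_succ_le hδ hδ1 hs) hM (fun s hs h8 a b => ?_)
    (Nat.succ_le_succ (Nat.zero_le _))
  have heq := PMOLB.isBarrierEquilibrium_strategies (PMOLB.learningRate_pos (d := d) hδ hδ1 hs)
    (PMOLB.gameEstimate (fun τ => i τ ω) (fun τ => j τ ω) (fun τ => r τ ω) s)
  have hpos := PMOLB.learningRate_pos (d := d) hδ hδ1 hs
  obtain ⟨hN, hacc⟩ := PMOLB.abs_deviation_le hδ hδ1 hs h8 (heq.le_row hpos (hM s) a)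
    (heq.le_col hpos (hM s) b) (hconc s hs a b _ rfl)
  rw [PMOLB.gameEstimate_succ_sub hs a b hN]
  exact hacc
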